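/- Let $P$ be a simple polygon in the Euclidean plane. For a point $x$ of $P$ let $\rho_x$ be the distance from $x$ to the boundary of $P$, and let $\mathrm{MEC}_x$ be the circle with center $x$ and radius $\rho_x$, i.e. the largest circle centered at $x$ that lies inside $P$. The medial axis $M$ of $P$ is the locus of the centers of all circles inside $P$ that touch the boundary of $P$ in two or more points, together with its leaves, which are the vertices of $P$ in the closure of this locus (the convex vertices). It is a tree. Its nodes are its leaves and its internal nodes, the points $x\in M$ for which $\mathrm{MEC}_x$ touches the boundary of $P$ in at least three distinct points. Let $R$ be the set of the radii $\rho_u$ of the circles $\mathrm{MEC}_u$ over all nodes $u$ of $M$. For a node $v$ of $M$, a circle $C=\mathrm{MEC}_c$ with $c\in M$ is called a guiding circle of $v$ if (i) its radius belongs to $R$; (ii) for every point $x$ on the path in $M$ from $v$ to $c$, endpoints included, $\rho_x\le\rho_c$; and (iii) $C$ overlaps $\mathrm{MEC}_v$, i.e. the open disks bounded by the two circles have a common point. For a real number $r$ let $S_v^r$ be the set of the guiding circles of $v$ that have radius $r$. Assume that $P$ is in general position in the following sense: distinct internal nodes $u\neq w$ of $M$ satisfy $\rho_u\ne\rho_w$,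 and every connected subset of $M$ that contains an internal node and on which $x\mapsto\rho_x$ is constant consists of a single point. Then for every node $v$ of $M$ and every $r\in R$ the set $S_v^r$ is finite and $|S_v^r|\le 36$. -/

import Mathlib

open Metric Set

noncomputable section

namespace QMEC

/-- The Euclidean plane. -/
abbrev Plane : Type := EuclideanSpace ℝ (Fin 2)

/-- A simple polygon: at least three vertices, all distinct, and two different edges meet only in
a common endpoint (so the closed polygonal curve does not cross or touch itself). -/
def IsSimple {n : ℕ} (P : Polygon Plane n) : Prop :=
  3 ≤ n ∧ Function.Injective P.vertices ∧
    ∀ i j : Fin n, i ≠ j →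
      P.edgeSet ℝ i ∩ P.edgeSet ℝ j ⊆ {P i, P (finRotate n i)} ∩ {P j, P (finRotate n j)}

/-- The open region enclosed by the polygon: the points off the boundary curve whose connected
component in the complement of the curve is bounded. -/
def inside {n : ℕ} (P : Polygon Plane n) : Set Plane :=
  {x | x ∉ P.boundary ℝ ∧ Bornology.IsBounded (connectedComponentIn (P.boundary ℝ)ᶜ x)}

/-- The distance from `x` to the boundary of the polygon. For `x` in the polygon this is the radius
of the largest circle centred at `x` that lies in the polygon. -/
def rho {n : ℕ} (P : Polygon Plane n) (x : Plane) : ℝ :=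
  infDist x (P.boundary ℝ)

/-- The circle `MEC_x`: the largest circle centred at `x` that lies in the polygon. -/
def mec {n : ℕ} (P : Polygon Plane n) (x : Plane) : EuclideanGeometry.Sphere Plane :=
  ⟨x, rho P x⟩

/-- The points of the boundary of the polygon that are touched by `MEC_x`. -/
def contacts {n : ℕ} (P : Polygon Plane n) (x : Plane) : Set Plane :=
  {b | b ∈ P.boundary ℝ ∧ dist b x = rho P x}

/-- The locus of the centres of the circles inside the polygon that touch its boundary in two or
more points. -/
def multiContact {n : ℕ} (P : Polygon Plane n) : Set Plane :=
  {x | x ∈ inside P ∧ 2 ≤ (contacts P x).encard}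

/-- The leaf nodes of the medial axis: the vertices of the polygon in which the medial axis ends
(its convex vertices). The circle `MEC_x` centred at a leaf is degenerate, of radius `0`. -/
def leafNodes {n : ℕ} (P : Polygon Plane n) : Set Plane :=
  {x | x ∈ range P.vertices ∧ x ∈ closure (multiContact P)}

/-- The medial axis of the polygon, including its leaves. -/
def medialAxis {n : ℕ} (P : Polygon Plane n) : Set Plane :=
  multiContact P ∪ leafNodes P

/-- The internal nodes of the medial axis: the centres of circles inside the polygon that touch its
boundary in three or more points. -/
def internalNodes {n : ℕ} (P : Polygon Plane n) : Set Plane :=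
  {x | x ∈ inside P ∧ 3 ≤ (contacts P x).encard}

/-- The nodes of the medial axis. -/
def nodes {n : ℕ} (P : Polygon Plane n) : Set Plane :=
  internalNodes P ∪ leafNodes P

/-- The set `R` of the radii of the circles `MEC_u` centred at the nodes `u`. -/
def radii {n : ℕ} (P : Polygon Plane n) : Set ℝ :=
  {r | ∃ u ∈ nodes P, (mec P u).radius = r}

/-- Two circles overlap if the open disks that they bound have a common point. -/
def Overlap (C D : EuclideanGeometry.Sphere Plane) : Prop :=
  (ball C.center C.radius ∩ ball D.center D.radius).Nonempty

/-- The guiding circles of `v`: the circles `MEC_c` with `c` on the medial axis such that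
(i) the radius of `MEC_c` belongs to `R`, (ii) no circle `MEC_x` with `x` on the path in the medial
axis from `v` to `c` is larger than `MEC_c`, and (iii) `MEC_c` overlaps `MEC_v`.

In (ii) the path is any continuous path in the medial axis, possibly constant. As the medial axis
is a tree, every such path passes through all points of the unique simple path from `v` to `c`,
so that a path as required exists if and only if the simple path is one. -/
def guidingCircles {n : ℕ} (P : Polygon Plane n) (v : Plane) :
    Set (EuclideanGeometry.Sphere Plane) :=
  {C | ∃ c ∈ medialAxis P, C = mec P c ∧
    C.radius ∈ radii P ∧
    (∃ γ : Path v c, ∀ t, γ t ∈ medialAxis P ∧ (mec P (γ t)).radius ≤ C.radius) ∧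
    Overlap C (mec P v)}

/-- The guiding circles of `v` whose radius is `r`. -/
def guidingCirclesOfRadius {n : ℕ} (P : Polygon Plane n) (v : Plane) (r : ℝ) :
    Set (EuclideanGeometry.Sphere Plane) :=
  {C | C ∈ guidingCircles P v ∧ C.radius = r}

/-- The circles `MEC_u` centred at the internal nodes `u` have pairwise distinct radii. (The
leaves have to be left out: their circles all have radius `0`.) -/
def DistinctNodeRadii {n : ℕ} (P : Polygon Plane n) : Prop :=
  ∀ u ∈ internalNodes P, ∀ w ∈ internalNodes P, (mec P u).radius = (mec P w).radius → u = w

/-- No nondegenerate connected piece of the medial axis that contains an internal node carries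
circles of one and the same radius. (Such a piece can only come from two parallel edges.) -/
def NoPlateauAtNode {n : ℕ} (P : Polygon Plane n) : Prop :=
  ∀ A : Set Plane, A ⊆ medialAxis P → IsPreconnected A → (A ∩ internalNodes P).Nonempty →
    (∀ x ∈ A, ∀ y ∈ A, (mec P x).radius = (mec P y).radius) → A.Subsingleton

end QMEC

end

open Metric Set Filter Topology

namespace QMEC

/-! A leaf has radius 0, so no circle overlaps its own. Let `v` be an internal node. Among the
centres of its guiding circles of radius `r` at most one is an internal node, since internal nodes
have distinct radii. It remains to bound the other centres by 35, which is done by area.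

Such a centre `c` has exactly two contacts `a` and `b`. They are not opposite: at a point with
opposite contacts the radius has a weak local minimum along the medial axis, so a path of radii at
most `r` ending there is constant in radius near its end, and the plateau propagates back to `v`,
against `NoPlateauAtNode` (`sub_ne_neg_sub_of_path`). So `a` and `b` lie on one open half of the
circle, and the opposite half disk is `farHalf`. The tangents at `a` and `b` show that centres of
radius at most `r` can approach `c` only through the sector between the radii to `a` and `b`
(`Frame.eventually_mem_nearSector`), and a point with two contacts lies on such a radius only if it
is `c`.

The boundary together with these two radii separates the near sector from the far half
(`Frame.exists_side`): off this set two branches of the logarithm of `(z - a) / (z - b)`, one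
following the boundary and one following the radii, differ by a locally constant multiple of `2πi`,
and this multiple jumps at `c`. Any other centre `c'` is joined to `c` through `v`, hence lies on
the near side (`Frame.eq_of_path`). A point of the far half of `c` that is at least as close to `c'`
could be joined to `c'` inside the disk of `c'` without crossing the radii, which is impossible
(`Frame.dist_lt_of_mem_farHalf`).

So points of a far half are closest to their own centre, and the far halves are pairwise disjoint.
Each contains a disk of radius `r / 2`, and all lie in a disk around `v` of radius less than `3 *
r`; area leaves room for fewer than 36. -/

/-! ### Complex and rotated coordinates in the plane -/

/-- The isometry of the plane with the complex numbers. -/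
noncomputable def toC : Plane ≃ₗᵢ[ℝ] ℂ := Complex.orthonormalBasisOneI.repr.symm

lemma toC_apply (x : Plane) : toC x = x 0 + x 1 * Complex.I :=
  Complex.orthonormalBasisOneI_repr_symm_apply x

/-- The rotation of the plane by a right angle. -/
noncomputable def rot (m : Plane) : Plane := !₂[-m 1, m 0]

lemma toC_rot (m : Plane) : toC (rot m) = Complex.I * toC m := by
  simp only [toC_apply, rot]
  apply Complex.ext <;> simp

lemma inner_eq (x y : Plane) : inner ℝ x y = x 0 * y 0 + x 1 * y 1 := by
  simp [PiLp.inner_apply, Fin.sum_univ_two, mul_comm]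

lemma inner_rot_self (m : Plane) : inner ℝ m (rot m) = 0 := by
  simp [inner_eq, rot]; ring

lemma inner_rot_rot (x y : Plane) : inner ℝ (rot x) (rot y) = inner ℝ x y := by
  simp [inner_eq, rot]; ring

lemma norm_sq_eq (x : Plane) : ‖x‖ ^ 2 = x 0 ^ 2 + x 1 ^ 2 := by
  rw [← real_inner_self_eq_norm_sq, inner_eq]; ring

lemma eq_inner_smul_add {m : Plane} (hm : ‖m‖ = 1) (x : Plane) :
    x = inner ℝ x m • m + inner ℝ x (rot m) • rot m := by
  have h : m 0 ^ 2 + m 1 ^ 2 = 1 := by rw [← norm_sq_eq, hm]; norm_num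
  ext i
  fin_cases i
  · simp [inner_eq, rot]; linear_combination (-x 0) * h
  · simp [inner_eq, rot]; linear_combination (-x 1) * h

lemma norm_sq_eq_inner_sq {m : Plane} (hm : ‖m‖ = 1) (x : Plane) :
    ‖x‖ ^ 2 = inner ℝ x m ^ 2 + inner ℝ x (rot m) ^ 2 := by
  have h : m 0 ^ 2 + m 1 ^ 2 = 1 := by rw [← norm_sq_eq, hm]; norm_num
  simp [inner_eq, rot, norm_sq_eq]; linear_combination (-x 0 ^ 2 - x 1 ^ 2) * h

/-! ### Continuous logarithms of `(z - a) / (z - b)` -/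

/-- There is a continuous logarithm of `(z - a) / (z - b)` off the set `B`. -/
def LogRatio (B : Set Plane) (a b : Plane) : Prop :=
  ∃ L : Plane → ℂ, ContinuousOn L Bᶜ ∧
    ∀ z ∉ B, Complex.exp (L z) = (toC z - toC a) / (toC z - toC b)

lemma toC_sub_ne {z a : Plane} (h : z ≠ a) : toC z - toC a ≠ 0 :=
  sub_ne_zero.2 fun h' => h (toC.injective h')

lemma LogRatio.refl {B : Set Plane} {a : Plane} (ha : a ∈ B) : LogRatio B a a :=
  ⟨fun _ => 0, continuousOn_const, fun z hz => by
    rw [Complex.exp_zero, div_self (toC_sub_ne (ne_of_mem_of_not_mem ha hz).symm)]⟩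

lemma LogRatio.symm {B : Set Plane} {a b : Plane} (h : LogRatio B a b) : LogRatio B b a := by
  obtain ⟨L, hL, h⟩ := h
  exact ⟨fun z => -L z, hL.neg, fun z hz => by rw [Complex.exp_neg, h z hz, inv_div]⟩

lemma LogRatio.trans {B : Set Plane} {a b c : Plane} (hb : b ∈ B) (h : LogRatio B a b)
    (h' : LogRatio B b c) : LogRatio B a c := by
  obtain ⟨L, hL, h⟩ := h
  obtain ⟨L', hL', h'⟩ := h'
  refine ⟨fun z => L z + L' z, hL.add hL', fun z hz => ?_⟩
  rw [Complex.exp_add, h z hz, h' z hz, div_mul_div_cancel₀]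
  exact toC_sub_ne fun h => hz (h ▸ hb)

/-- If the quotient were a real `t ≤ 0`, then `z` would be the convex combination of `a` and `b`
with weights `1 / (1 - t)` and `-t / (1 - t)`. Hence the principal logarithm is continuous off the
segment. -/
lemma ratio_mem_slitPlane {z a b : Plane} (hz : z ∉ segment ℝ a b) :
    (toC z - toC a) / (toC z - toC b) ∈ Complex.slitPlane := by
  have hb : toC z - toC b ≠ 0 := toC_sub_ne fun h => hz (h ▸ right_mem_segment ℝ a b)
  by_contra hn
  rw [Complex.mem_slitPlane_iff_not_le_zero, not_not] at hn
  obtain ⟨h1, h2⟩ := Complex.le_def.1 hn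
  set w := (toC z - toC a) / (toC z - toC b) with hw
  have hwt : w = (w.re : ℂ) := Complex.ext rfl (by simpa using h2)
  set t := w.re
  have h1 : t ≤ 0 := h1
  have h3 : toC z - toC a = t * (toC z - toC b) := by
    rw [← hwt, hw, div_mul_cancel₀ _ hb]
  have h4 : z - a = t • (z - b) := toC.injective (by
    rw [map_sub, map_smul, map_sub, h3, Complex.real_smul])
  apply hz
  have ht : (1 - t) ≠ 0 := by linarith
  refine ⟨1 / (1 - t), -t / (1 - t), by apply div_nonneg <;> linarith,
    by apply div_nonneg <;> linarith, by field_simp; ring, ?_⟩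
  have h5 : (1 - t) • z = a + (-t) • b := by
    have : z = a + t • (z - b) := by rw [← h4]; abel
    rw [sub_smul, one_smul]
    nth_rewrite 1 [this]
    module
  have h6 : z = (1 / (1 - t)) • ((1 - t) • z) := by
    rw [smul_smul, one_div_mul_cancel ht, one_smul]
  rw [h6, h5]
  module

lemma continuousOn_log_ratio (a b : Plane) :
    ContinuousOn (fun z : Plane => Complex.log ((toC z - toC a) / (toC z - toC b)))
      (segment ℝ a b)ᶜ := by
  refine ContinuousOn.clog (ContinuousOn.div ?_ ?_ ?_) fun z hz => ratio_mem_slitPlane hz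
  · exact (toC.continuous.sub continuous_const).continuousOn
  · exact (toC.continuous.sub continuous_const).continuousOn
  · exact fun z hz => toC_sub_ne fun h => hz (h ▸ right_mem_segment ℝ a b)

lemma exp_log_ratio {z a b : Plane} (hz : z ∉ segment ℝ a b) :
    Complex.exp (Complex.log ((toC z - toC a) / (toC z - toC b))) =
      (toC z - toC a) / (toC z - toC b) :=
  Complex.exp_log (Complex.slitPlane_ne_zero (ratio_mem_slitPlane hz))

lemma LogRatio.of_segment_subset {B : Set Plane} {a b : Plane} (h : segment ℝ a b ⊆ B) :
    LogRatio B a b :=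
  ⟨_, (continuousOn_log_ratio a b).mono (compl_subset_compl.2 h),
    fun _ hz => exp_log_ratio fun h' => hz (h h')⟩

/-! ### Two radii separate the near sector from the far half -/

/-- A point `c` at distance `r` from two points `a` and `b`, which lie symmetrically to the
direction `m` and make with it an acute angle of cosine `C` and sine `S`. -/
structure Frame (c a b m : Plane) (r C S : ℝ) : Prop where
  r_pos : 0 < r
  norm_m : ‖m‖ = 1
  C_pos : 0 < C
  S_pos : 0 < S
  sq_add : C ^ 2 + S ^ 2 = 1
  a_eq : a = c + r • (C • m + S • rot m)
  b_eq : b = c + r • (C • m - S • rot m)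

/-- The part of the disk between its radii to the two contact points of the frame. -/
def nearSector (c m : Plane) (r C S : ℝ) : Set Plane :=
  {x | dist x c < r ∧ |inner ℝ (x - c) (rot m)| * C < inner ℝ (x - c) m * S}

/-- The half of the disk that is opposite to the contact points. -/
def farHalf (c m : Plane) (r : ℝ) : Set Plane := {x | dist x c < r ∧ inner ℝ (x - c) m < 0}

lemma convex_nearSector (c m : Plane) (r : ℝ) {C S : ℝ} (hC : 0 < C) :
    Convex ℝ (nearSector c m r C S) := by
  rintro x ⟨hx1, hx2⟩ y ⟨hy1, hy2⟩ s t hs ht hst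
  refine ⟨(convex_ball c r) hx1 hy1 hs ht hst, ?_⟩
  have e : s • x + t • y - c = s • (x - c) + t • (y - c) := by
    have : c = (s + t) • c := by rw [hst, one_smul]
    nth_rewrite 1 [this]; module
  rw [e, inner_add_left, inner_add_left, inner_smul_left, inner_smul_left, inner_smul_left,
    inner_smul_left]
  simp only [conj_trivial]
  have h := abs_add_le (s * inner ℝ (x - c) (rot m)) (t * inner ℝ (y - c) (rot m))
  rw [abs_mul, abs_mul, abs_of_nonneg hs, abs_of_nonneg ht] at h
  have h1 := mul_le_mul_of_nonneg_right h hC.le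
  rcases hs.eq_or_lt with rfl | hs
  · have : t = 1 := by linarith
    subst this
    nlinarith
  · nlinarith [mul_lt_mul_of_pos_left hx2 hs, mul_le_mul_of_nonneg_left hy2.le ht]

lemma convex_farHalf (c m : Plane) (r : ℝ) : Convex ℝ (farHalf c m r) := by
  rintro x ⟨hx1, hx2⟩ y ⟨hy1, hy2⟩ s t hs ht hst
  refine ⟨(convex_ball c r) hx1 hy1 hs ht hst, ?_⟩
  have e : s • x + t • y - c = s • (x - c) + t • (y - c) := by
    have : c = (s + t) • c := by rw [hst, one_smul]
    nth_rewrite 1 [this]; module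
  rw [e, inner_add_left, inner_smul_left, inner_smul_left]
  simp only [conj_trivial]
  rcases hs.eq_or_lt with rfl | hs
  · have : t = 1 := by linarith
    subst this
    nlinarith
  · nlinarith

namespace Frame

variable {c a b m : Plane} {r C S : ℝ}

lemma inner_rot_rot_self (h : Frame c a b m r C S) : inner ℝ (rot m) (rot m) = 1 := by
  rw [inner_rot_rot, real_inner_self_eq_norm_sq, h.norm_m]; norm_num

lemma inner_self (h : Frame c a b m r C S) : inner ℝ m m = 1 := by
  rw [real_inner_self_eq_norm_sq, h.norm_m]; norm_num

lemma inner_a_m (h : Frame c a b m r C S) : inner ℝ (a - c) m = r * C := by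
  rw [h.a_eq, add_sub_cancel_left, inner_smul_left, inner_add_left, inner_smul_left,
    inner_smul_left, h.inner_self, real_inner_comm, inner_rot_self]
  simp

lemma inner_a_rot (h : Frame c a b m r C S) : inner ℝ (a - c) (rot m) = r * S := by
  rw [h.a_eq, add_sub_cancel_left, inner_smul_left, inner_add_left, inner_smul_left,
    inner_smul_left, h.inner_rot_rot_self, inner_rot_self]
  simp

lemma inner_b_m (h : Frame c a b m r C S) : inner ℝ (b - c) m = r * C := by
  rw [h.b_eq, add_sub_cancel_left, inner_smul_left, inner_sub_left, inner_smul_left,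
    inner_smul_left, h.inner_self, real_inner_comm, inner_rot_self]
  simp

lemma inner_b_rot (h : Frame c a b m r C S) : inner ℝ (b - c) (rot m) = -(r * S) := by
  rw [h.b_eq, add_sub_cancel_left, inner_smul_left, inner_sub_left, inner_smul_left,
    inner_smul_left, h.inner_rot_rot_self, inner_rot_self]
  simp

lemma spoke_a (h : Frame c a b m r C S) {x : Plane} (hx : x ∈ segment ℝ c a) :
    ∃ t : ℝ, 0 ≤ t ∧ t ≤ 1 ∧ inner ℝ (x - c) m = t * r * C ∧
      inner ℝ (x - c) (rot m) = t * r * S := by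
  rw [segment_eq_image'] at hx
  obtain ⟨t, ⟨h0, h1⟩, rfl⟩ := hx
  refine ⟨t, h0, h1, ?_, ?_⟩
  · rw [add_sub_cancel_left, inner_smul_left, h.inner_a_m]; simp [mul_assoc]
  · rw [add_sub_cancel_left, inner_smul_left, h.inner_a_rot]; simp [mul_assoc]

lemma spoke_b (h : Frame c a b m r C S) {x : Plane} (hx : x ∈ segment ℝ c b) :
    ∃ t : ℝ, 0 ≤ t ∧ t ≤ 1 ∧ inner ℝ (x - c) m = t * r * C ∧
      inner ℝ (x - c) (rot m) = -(t * r * S) := by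
  rw [segment_eq_image'] at hx
  obtain ⟨t, ⟨h0, h1⟩, rfl⟩ := hx
  refine ⟨t, h0, h1, ?_, ?_⟩
  · rw [add_sub_cancel_left, inner_smul_left, h.inner_b_m]; simp [mul_assoc]
  · rw [add_sub_cancel_left, inner_smul_left, h.inner_b_rot]; simp [mul_assoc]

lemma not_mem_spokes_of_inner_neg (h : Frame c a b m r C S) {x : Plane}
    (hx : inner ℝ (x - c) m < 0) : x ∉ segment ℝ c a ∧ x ∉ segment ℝ c b := by
  have hr := h.r_pos
  have hC := h.C_pos
  constructor
  · intro h'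
    obtain ⟨t, h0, -, e, -⟩ := h.spoke_a h'
    have : 0 ≤ t * r * C := by positivity
    linarith
  · intro h'
    obtain ⟨t, h0, -, e, -⟩ := h.spoke_b h'
    have : 0 ≤ t * r * C := by positivity
    linarith

lemma not_mem_spokes_of_mem_nearSector (h : Frame c a b m r C S) {x : Plane}
    (hx : x ∈ nearSector c m r C S) : x ∉ segment ℝ c a ∧ x ∉ segment ℝ c b := by
  have hr := h.r_pos
  have hS := h.S_pos
  obtain ⟨-, hx⟩ := hx
  constructor
  · intro h'
    obtain ⟨t, h0, -, e, e'⟩ := h.spoke_a h'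
    rw [e, e', abs_of_nonneg (by positivity)] at hx
    linarith
  · intro h'
    obtain ⟨t, h0, -, e, e'⟩ := h.spoke_b h'
    rw [e, e', abs_neg, abs_of_nonneg (by positivity)] at hx
    linarith

end Frame

namespace Frame

variable {c a b m : Plane} {r C S : ℝ}

lemma add_mem_nearSector (h : Frame c a b m r C S) {t : ℝ} (ht : 0 < t) (htr : t < r) :
    c + t • m ∈ nearSector c m r C S := by
  have hS := h.S_pos
  refine ⟨?_, ?_⟩
  · rw [dist_eq_norm, add_sub_cancel_left, norm_smul, h.norm_m, Real.norm_of_nonneg ht.le]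
    linarith
  · rw [add_sub_cancel_left, inner_smul_left, inner_smul_left, inner_rot_self, h.inner_self]
    simp only [conj_trivial, mul_zero, abs_zero, zero_mul, mul_one]
    positivity

lemma sub_mem_farHalf (h : Frame c a b m r C S) {t : ℝ} (ht : 0 < t) (htr : t < r) :
    c - t • m ∈ farHalf c m r := by
  refine ⟨?_, ?_⟩
  · rw [dist_eq_norm, sub_sub_cancel_left, norm_neg, norm_smul, h.norm_m,
      Real.norm_of_nonneg ht.le]
    linarith
  · rw [sub_sub_cancel_left, inner_neg_left, inner_smul_left, h.inner_self]
    simpa using ht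

/-- The total variation of the argument along the two radii, seen from the points `c + t • m` and
`c - t • m`. -/
lemma tendsto_log_spokes (h : Frame c a b m r C S) {LQ : Plane → ℂ}
    (hLQ : ∀ z, LQ z = Complex.log ((toC z - toC a) / (toC z - toC c)) +
      Complex.log ((toC z - toC c) / (toC z - toC b))) :
    ¬ Tendsto (fun t : ℝ => (LQ (c + t • m)).im - (LQ (c - t • m)).im) (𝓝[>] 0) (𝓝 0) := by
  intro hlim
  have hr := h.r_pos
  have hS := h.S_pos
  have hμ : toC m ≠ 0 := by
    rw [← norm_ne_zero_iff, toC.norm_map, h.norm_m]; exact one_ne_zero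
  set κ : ℂ := C + S * Complex.I with hκ
  set κ' : ℂ := C - S * Complex.I with hκ'
  have hkk : κ * κ' = 1 := by
    have : (C : ℂ) ^ 2 + (S : ℂ) ^ 2 = 1 := by exact_mod_cast h.sq_add
    rw [hκ, hκ']
    linear_combination this - (S : ℂ) ^ 2 * Complex.I_sq
  have hκ0 : κ ≠ 0 := left_ne_zero_of_mul_eq_one hkk
  have hκ'0 : κ' ≠ 0 := right_ne_zero_of_mul_eq_one hkk
  have hr0 : (r : ℂ) ≠ 0 := by exact_mod_cast hr.ne'
  have ea : toC a = toC c + r * (toC m * κ) := by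
    rw [h.a_eq]
    simp only [map_add, map_smul, toC_rot, Complex.real_smul, hκ]; ring
  have eb : toC b = toC c + r * (toC m * κ') := by
    rw [h.b_eq]
    simp only [map_add, map_sub, map_smul, toC_rot, Complex.real_smul, hκ']; ring
  -- Arguments ignore positive factors. Dropping the factors `t` and `t⁻¹` from the quotients leaves
  -- an expression that is continuous at `t = 0`.
  let G : ℝ → ℝ := fun t => Complex.arg (t - r * κ) + Complex.arg ((t - r * κ')⁻¹)
    - (Complex.arg (t + r * κ) + Complex.arg ((t + r * κ')⁻¹))
  have slit : ∀ z : ℂ, z.im ≠ 0 → z ∈ Complex.slitPlane := fun z hz =>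
    Complex.mem_slitPlane_iff.2 (Or.inr hz)
  have hG : ContinuousAt G 0 := by
    have i1 : (((0 : ℝ) : ℂ) - r * κ).im ≠ 0 := by simp [hκ, hr.ne', hS.ne']
    have i2 : (((0 : ℝ) : ℂ) + r * κ).im ≠ 0 := by simp [hκ, hr.ne', hS.ne']
    have i3 : (((0 : ℝ) : ℂ) - r * κ').im ≠ 0 := by simp [hκ', hr.ne', hS.ne']
    have i4 : (((0 : ℝ) : ℂ) + r * κ').im ≠ 0 := by simp [hκ', hr.ne', hS.ne']
    have n3 : (((0 : ℝ) : ℂ) - r * κ') ≠ 0 := fun h => i3 (by rw [h]; rfl)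
    have n4 : (((0 : ℝ) : ℂ) + r * κ') ≠ 0 := fun h => i4 (by rw [h]; rfl)
    have j3 : (((0 : ℝ) : ℂ) - r * κ')⁻¹.im ≠ 0 := by
      rw [Complex.inv_im]; exact div_ne_zero (neg_ne_zero.2 i3) (by simpa using n3)
    have j4 : (((0 : ℝ) : ℂ) + r * κ')⁻¹.im ≠ 0 := by
      rw [Complex.inv_im]; exact div_ne_zero (neg_ne_zero.2 i4) (by simpa using n4)
    have aux : ∀ f : ℝ → ℂ, ContinuousAt f 0 → (f 0).im ≠ 0 →
        ContinuousAt (fun t => Complex.arg (f t)) 0 := fun f hf h0 =>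
      ContinuousAt.comp (f := f) (g := Complex.arg) (Complex.continuousAt_arg (slit _ h0)) hf
    have c1 : ∀ w : ℂ, ContinuousAt (fun t : ℝ => (t : ℂ) - w) 0 := fun w => by fun_prop
    have c2 : ∀ w : ℂ, ContinuousAt (fun t : ℝ => (t : ℂ) + w) 0 := fun w => by fun_prop
    exact ((aux _ (c1 _) i1).add (aux _ ((c1 _).inv₀ n3) j3)).sub
      ((aux _ (c2 _) i2).add (aux _ ((c2 _).inv₀ n4) j4))
  have hG0 : G 0 = 0 := by
    refine tendsto_nhds_unique (hG.tendsto.mono_left nhdsWithin_le_nhds) (hlim.congr' ?_)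
    filter_upwards [self_mem_nhdsWithin] with t (ht : 0 < t)
    have ht0 : (t : ℂ) ≠ 0 := by exact_mod_cast ht.ne'
    have hti : (0 : ℝ) < t⁻¹ := inv_pos.2 ht
    rw [hLQ, hLQ]
    simp only [Complex.add_im, Complex.log_im, G]
    have e1 : (toC (c + t • m) - toC a) / (toC (c + t • m) - toC c) =
        (t⁻¹ : ℝ) * (t - r * κ) := by
      rw [ea, map_add, map_smul, Complex.real_smul, Complex.ofReal_inv]
      field_simp; ring
    have e2 : (toC (c + t • m) - toC c) / (toC (c + t • m) - toC b) =
        (t : ℝ) * (t - r * κ')⁻¹ := by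
      rw [eb, map_add, map_smul, Complex.real_smul, add_sub_cancel_left, add_sub_add_left_eq_sub,
        show (t : ℂ) * toC m - r * (toC m * κ') = (t - r * κ') * toC m by ring,
        mul_div_mul_right _ _ hμ, div_eq_mul_inv]
    have e3 : (toC (c - t • m) - toC a) / (toC (c - t • m) - toC c) =
        (t⁻¹ : ℝ) * (t + r * κ) := by
      rw [ea, map_sub, map_smul, Complex.real_smul, Complex.ofReal_inv,
        show toC c - t * toC m - (toC c + r * (toC m * κ)) = (t + r * κ) * -toC m by ring,
        show toC c - t * toC m - toC c = t * -toC m by ring,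
        mul_div_mul_right _ _ (neg_ne_zero.2 hμ), div_eq_inv_mul]
    have e4 : (toC (c - t • m) - toC c) / (toC (c - t • m) - toC b) =
        (t : ℝ) * (t + r * κ')⁻¹ := by
      rw [eb, map_sub, map_smul, Complex.real_smul,
        show toC c - t * toC m - (toC c + r * (toC m * κ')) = (t + r * κ') * -toC m by ring,
        show toC c - t * toC m - toC c = t * -toC m by ring,
        mul_div_mul_right _ _ (neg_ne_zero.2 hμ), div_eq_mul_inv]
    rw [e1, e2, e3, e4, Complex.arg_real_mul _ hti, Complex.arg_real_mul _ hti,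
      Complex.arg_real_mul _ ht, Complex.arg_real_mul _ ht]
  have hri : (0 : ℝ) < r⁻¹ := inv_pos.2 hr
  have hinv : κ'⁻¹ = κ := inv_eq_of_mul_eq_one_left hkk
  have g1 : Complex.arg (((0 : ℝ) : ℂ) - r * κ) = Complex.arg (-κ) := by
    rw [Complex.ofReal_zero, zero_sub, ← mul_neg, Complex.arg_real_mul _ hr]
  have g2 : Complex.arg (((0 : ℝ) : ℂ) + r * κ) = Complex.arg κ := by
    rw [Complex.ofReal_zero, zero_add, Complex.arg_real_mul _ hr]
  have g3 : Complex.arg (((0 : ℝ) : ℂ) - r * κ')⁻¹ = Complex.arg (-κ) := by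
    rw [Complex.ofReal_zero, zero_sub, ← mul_neg, mul_inv, inv_neg, hinv, ← Complex.ofReal_inv,
      Complex.arg_real_mul _ hri]
  have g4 : Complex.arg (((0 : ℝ) : ℂ) + r * κ')⁻¹ = Complex.arg κ := by
    rw [Complex.ofReal_zero, zero_add, mul_inv, hinv, ← Complex.ofReal_inv,
      Complex.arg_real_mul _ hri]
  simp only [G, g1, g2, g3, g4] at hG0
  -- At `t = 0` the jump is `2 * (arg (-κ) - arg κ)`.
  have hneg : -κ = κ := Complex.ext_norm_arg (norm_neg _) (by linarith)
  exact hκ0 (self_eq_neg.1 hneg.symm)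

/-- The two radii to `a` and `b` separate the near sector of the disk from its far half in the
complement of a set `B` around which the argument of `(z - a) / (z - b)` has no monodromy. -/
theorem exists_side (h : Frame c a b m r C S) {B : Set Plane}
    (hB : ∀ x, dist x c < r → x ∉ B) (hL : LogRatio B a b) :
    ∃ (W : Plane → ℤ) (k l : ℤ),
      ContinuousOn W (B ∪ (segment ℝ c a ∪ segment ℝ c b))ᶜ ∧ k ≠ l ∧
      (∀ x ∈ nearSector c m r C S, W x = k) ∧ ∀ x ∈ farHalf c m r, W x = l := by
  obtain ⟨L, hLc, hL⟩ := hL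
  have hr := h.r_pos
  set X := (B ∪ (segment ℝ c a ∪ segment ℝ c b))ᶜ with hX
  let LQ : Plane → ℂ := fun z => Complex.log ((toC z - toC a) / (toC z - toC c)) +
      Complex.log ((toC z - toC c) / (toC z - toC b))
  have hLQc : ContinuousOn LQ X := by
    have s1 : X ⊆ (segment ℝ a c)ᶜ := fun x hx h' =>
      hx (Or.inr (Or.inl (by rwa [segment_symm])))
    have s2 : X ⊆ (segment ℝ c b)ᶜ := fun x hx h' => hx (Or.inr (Or.inr h'))
    exact ((continuousOn_log_ratio a c).mono s1).add ((continuousOn_log_ratio c b).mono s2)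
  have hLc' : ContinuousOn L X := hLc.mono fun x hx h' => hx (Or.inl h')
  -- Both logarithms exponentiate to `(z - a) / (z - b)` on `X`, so the rounded number is already an
  -- integer there.
  let W : Plane → ℤ := fun z => round ((L z - LQ z).im / (2 * Real.pi))
  have hW : ∀ z ∈ X, (W z : ℝ) = (L z - LQ z).im / (2 * Real.pi) := by
    intro z hz
    have h1 : z ∉ segment ℝ a c := fun h' => hz (Or.inr (Or.inl (by rwa [segment_symm])))
    have h2 : z ∉ segment ℝ c b := fun h' => hz (Or.inr (Or.inr h'))
    have e : Complex.exp (L z - LQ z) = 1 := by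
      have hne : toC z - toC c ≠ 0 := toC_sub_ne fun h' => h2 (h' ▸ left_mem_segment ℝ c b)
      have hnea : toC z - toC a ≠ 0 := toC_sub_ne fun h' => h1 (h' ▸ left_mem_segment ℝ a c)
      have hneb : toC z - toC b ≠ 0 := toC_sub_ne fun h' => h2 (h' ▸ right_mem_segment ℝ c b)
      rw [Complex.exp_sub, Complex.exp_add, exp_log_ratio h1, exp_log_ratio h2,
        hL z fun h' => hz (Or.inl h')]
      field_simp
    obtain ⟨n, hn⟩ := Complex.exp_eq_one_iff.1 e
    have : (L z - LQ z).im / (2 * Real.pi) = n := by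
      rw [hn]
      simp
    simp only [W, this, round_intCast]
  have hWc : ContinuousOn W X := by
    rw [Int.isClosedEmbedding_coe_real.isInducing.continuousOn_iff]
    refine ContinuousOn.congr ?_ fun z hz => hW z hz
    exact (Complex.continuous_im.comp_continuousOn (hLc'.sub hLQc)).div_const _
  have hnear : nearSector c m r C S ⊆ X := fun x hx h' => by
    obtain ⟨h1, h2⟩ := h.not_mem_spokes_of_mem_nearSector hx
    rcases h' with h' | h' | h'
    exacts [hB x hx.1 h', h1 h', h2 h']
  have hfar : farHalf c m r ⊆ X := fun x hx h' => by
    obtain ⟨h1, h2⟩ := h.not_mem_spokes_of_inner_neg hx.2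
    rcases h' with h' | h' | h'
    exacts [hB x hx.1 h', h1 h', h2 h']
  have hx0 := h.add_mem_nearSector (half_pos hr) (half_lt_self hr)
  have hy0 := h.sub_mem_farHalf (half_pos hr) (half_lt_self hr)
  have kn : ∀ x ∈ nearSector c m r C S, W x = W (c + (r / 2) • m) := fun x hx =>
    (convex_nearSector c m r h.C_pos).isPreconnected.constant (hWc.mono hnear) hx hx0
  have kf : ∀ x ∈ farHalf c m r, W x = W (c - (r / 2) • m) := fun x hx =>
    (convex_farHalf c m r).isPreconnected.constant (hWc.mono hfar) hx hy0
  -- If `W` agreed on the two sides, `LQ` would have the same jump at `c` as `L`, which is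
  -- continuous there.
  refine ⟨W, _, _, hWc, fun heq => ?_, kn, kf⟩
  refine h.tendsto_log_spokes (LQ := LQ) (fun z => rfl) ?_
  have hLcont : ContinuousAt L c :=
    (hLc.mono (t := ball c r) fun x hx => hB x hx).continuousAt (ball_mem_nhds c hr)
  have l1 : Tendsto (fun t : ℝ => c + t • m) (𝓝[>] 0) (𝓝 c) := by
    have : Tendsto (fun t : ℝ => c + t • m) (𝓝 0) (𝓝 (c + (0 : ℝ) • m)) :=
      Continuous.tendsto (by fun_prop) 0
    rw [zero_smul, add_zero] at this
    exact this.mono_left nhdsWithin_le_nhds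
  have l2 : Tendsto (fun t : ℝ => c - t • m) (𝓝[>] 0) (𝓝 c) := by
    have : Tendsto (fun t : ℝ => c - t • m) (𝓝 0) (𝓝 (c - (0 : ℝ) • m)) :=
      Continuous.tendsto (by fun_prop) 0
    rw [zero_smul, sub_zero] at this
    exact this.mono_left nhdsWithin_le_nhds
  have hLi : ContinuousAt (fun z => (L z).im) c :=
    Complex.continuous_im.continuousAt.comp hLcont
  have hlim := (hLi.tendsto.comp l1).sub (hLi.tendsto.comp l2)
  rw [sub_self] at hlim
  refine hlim.congr' ?_
  filter_upwards [Ioo_mem_nhdsGT hr] with t ⟨ht, htr⟩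
  have hn := h.add_mem_nearSector ht htr
  have hf := h.sub_mem_farHalf ht htr
  have e : (W (c + t • m) : ℝ) = W (c - t • m) := by rw [kn _ hn, kf _ hf, heq]
  rw [hW _ (hnear hn), hW _ (hfar hf)] at e
  have hpi := Real.pi_pos
  have e' := (div_left_inj' (by positivity : (2 * Real.pi) ≠ 0)).1 e
  simp only [Complex.sub_im] at e'
  simp only [Function.comp]
  linarith

end Frame

/-! ### Nearest points of convex sets, the boundary and its distance function -/

lemma inner_sub_nonpos_of_forall_dist_le {E : Set Plane} (hE : Convex ℝ E) {c a y : Plane}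
    (ha : a ∈ E) (h : ∀ z ∈ E, dist c a ≤ dist c z) (hy : y ∈ E) :
    inner ℝ (c - a) (y - a) ≤ 0 := by
  have hinf : ‖c - a‖ = ⨅ w : E, ‖c - w‖ := by
    have : Nonempty E := ⟨⟨a, ha⟩⟩
    refine le_antisymm (le_ciInf fun w => ?_) (ciInf_le ⟨0, ?_⟩ (⟨a, ha⟩ : E))
    · simpa [dist_eq_norm] using h w w.2
    · rintro _ ⟨w, rfl⟩
      exact norm_nonneg _
  exact (norm_eq_iInf_iff_real_inner_le_zero hE ha).1 hinf y hy

lemma inner_sub_pos_of_dist_le {x a y : Plane} (h : dist x y ≤ dist x a) (hy : y ≠ a) :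
    0 < inner ℝ (x - a) (y - a) := by
  have h1 : ‖x - y‖ ^ 2 = ‖x - a‖ ^ 2 - 2 * inner ℝ (x - a) (y - a) + ‖y - a‖ ^ 2 := by
    rw [← norm_sub_sq_real, sub_sub_sub_cancel_right]
  have h2 : 0 < ‖y - a‖ := norm_pos_iff.2 (sub_ne_zero.2 hy)
  rw [dist_eq_norm, dist_eq_norm] at h
  have h3 : ‖x - y‖ ^ 2 ≤ ‖x - a‖ ^ 2 := by gcongr
  nlinarith

lemma eq_of_dist_eq_of_forall_dist_le {E : Set Plane} (hE : Convex ℝ E) {x y z : Plane} {d : ℝ}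
    (h : ∀ w ∈ E, d ≤ dist w x) (hy : y ∈ E) (hz : z ∈ E) (hyd : dist y x = d)
    (hzd : dist z x = d) : y = z := by
  by_contra hne
  have h0 : ∀ w ∈ E, dist x y ≤ dist x w := fun w hw => by
    rw [dist_comm x y, hyd, dist_comm x w]; exact h w hw
  have h1 := inner_sub_nonpos_of_forall_dist_le hE hy h0 hz
  have h2 := inner_sub_pos_of_dist_le (x := x) (a := y) (y := z)
    (by rw [dist_comm x z, dist_comm x y, hyd, hzd]) (Ne.symm hne)
  linarith

variable {n : ℕ} {P : Polygon Plane n}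

lemma edgeSet_eq_segment (P : Polygon Plane n) (i : Fin n) :
    P.edgeSet ℝ i = segment ℝ (P i) (P (finRotate n i)) := affineSegment_eq_segment ℝ _ _

lemma edgeSet_subset_boundary (P : Polygon Plane n) (i : Fin n) :
    P.edgeSet ℝ i ⊆ P.boundary ℝ := subset_iUnion (fun i => P.edgeSet ℝ i) i

lemma convex_edgeSet (P : Polygon Plane n) (i : Fin n) : Convex ℝ (P.edgeSet ℝ i) := by
  rw [edgeSet_eq_segment]; exact convex_segment _ _

lemma isClosed_segment (a b : Plane) : IsClosed (segment ℝ a b) := by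
  rw [segment_eq_image_lineMap]
  exact (isCompact_Icc.image AffineMap.lineMap_continuous).isClosed

lemma isClosed_edgeSet (P : Polygon Plane n) (i : Fin n) : IsClosed (P.edgeSet ℝ i) := by
  rw [edgeSet_eq_segment]; exact isClosed_segment _ _

lemma isClosed_boundary (P : Polygon Plane n) : IsClosed (P.boundary ℝ) :=
  isClosed_iUnion_of_finite fun i => isClosed_edgeSet P i

lemma vertex_mem_edgeSet (P : Polygon Plane n) (i : Fin n) : P i ∈ P.edgeSet ℝ i := by
  rw [edgeSet_eq_segment]; exact left_mem_segment ℝ _ _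

lemma vertex_mem_boundary (P : Polygon Plane n) (i : Fin n) : P i ∈ P.boundary ℝ :=
  edgeSet_subset_boundary P i (vertex_mem_edgeSet P i)

lemma rho_le_dist {x y : Plane} (hy : y ∈ P.boundary ℝ) : rho P x ≤ dist y x := by
  rw [dist_comm]; exact infDist_le_dist_of_mem hy

lemma continuous_rho (P : Polygon Plane n) : Continuous (rho P) := continuous_infDist_pt _

lemma rho_nonneg (P : Polygon Plane n) (x : Plane) : 0 ≤ rho P x := infDist_nonneg

lemma rho_eq_zero_of_mem {x : Plane} (hx : x ∈ P.boundary ℝ) : rho P x = 0 :=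
  infDist_zero_of_mem hx

lemma rho_pos {x : Plane} (hne : (P.boundary ℝ).Nonempty) (hx : x ∉ P.boundary ℝ) :
    0 < rho P x :=
  ((isClosed_boundary P).notMem_iff_infDist_pos hne).1 hx

/-- Quotients telescope along the chain of vertices and then along part of one edge; each link is a
segment inside the boundary. -/
lemma logRatio_boundary (P : Polygon Plane n) {a b : Plane} (ha : a ∈ P.boundary ℝ)
    (hb : b ∈ P.boundary ℝ) : LogRatio (P.boundary ℝ) a b := by
  rcases n with _ | n
  · obtain ⟨i, -⟩ := mem_iUnion.1 ha
    exact i.elim0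
  have hv : ∀ k (hk : k < n + 1), LogRatio (P.boundary ℝ) (P 0) (P ⟨k, hk⟩) := by
    intro k
    induction k with
    | zero => exact fun _ => LogRatio.refl (vertex_mem_boundary P _)
    | succ k ih =>
      intro hk
      refine (ih (by omega)).trans (vertex_mem_boundary P _) (LogRatio.of_segment_subset ?_)
      have h := edgeSet_subset_boundary P ⟨k, by omega⟩
      rwa [edgeSet_eq_segment, finRotate_of_lt (by omega)] at h
  have hp : ∀ x ∈ P.boundary ℝ, LogRatio (P.boundary ℝ) (P 0) x := by
    intro x hx
    obtain ⟨i, hi⟩ := mem_iUnion.1 hx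
    refine (hv i i.2).trans (vertex_mem_boundary P _) (LogRatio.of_segment_subset ?_)
    exact ((convex_edgeSet P i).segment_subset (vertex_mem_edgeSet P i) hi).trans
      (edgeSet_subset_boundary P i)
  exact (hp a ha).symm.trans (vertex_mem_boundary P _) (hp b hb)

/-! ### Contacts of points near a given centre -/

/-- Upper semicontinuity of the contacts: the boundary outside `U` is strictly farther from `c` than
`rho P c`, and both distances are continuous. -/
lemma eventually_contacts_subset {c : Plane} {U : Set Plane}
    (hU : ∀ y ∈ contacts P c, U ∈ 𝓝 y) : ∀ᶠ x in 𝓝 c, contacts P x ⊆ U := by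
  set K := P.boundary ℝ \ interior U with hK
  have hKc : IsClosed K := (isClosed_boundary P).sdiff isOpen_interior
  rcases K.eq_empty_or_nonempty with h0 | hne
  · exact Eventually.of_forall fun x y hy => interior_subset (sdiff_eq_empty.1 h0 hy.1)
  have hlt : rho P c < infDist c K := by
    obtain ⟨y, hy, hyd⟩ := hKc.exists_infDist_eq_dist hne c
    rw [hyd]
    refine lt_of_le_of_ne (infDist_le_dist_of_mem hy.1) fun h => hy.2 ?_
    exact mem_interior_iff_mem_nhds.2 (hU y ⟨hy.1, by rw [dist_comm]; exact h.symm⟩)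
  have := (continuous_rho P).continuousAt.eventually_lt
    (continuous_infDist_pt K).continuousAt hlt
  filter_upwards [this] with x hx y hy
  by_contra hyU
  have h1 : infDist x K ≤ dist x y :=
    infDist_le_dist_of_mem ⟨hy.1, fun h => hyU (interior_subset h)⟩
  rw [dist_comm, hy.2] at h1
  linarith

lemma eventually_mem_edgeSet (P : Polygon Plane n) (a : Plane) :
    ∀ᶠ y in 𝓝 a, ∀ i, y ∈ P.edgeSet ℝ i → a ∈ P.edgeSet ℝ i := by
  rw [eventually_all]
  intro i
  by_cases h : a ∈ P.edgeSet ℝ i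
  · exact Eventually.of_forall fun y _ => h
  · filter_upwards [(isClosed_edgeSet P i).isOpen_compl.mem_nhds h] with y hy hy'
    exact absurd hy' hy

lemma contact_unique_of_convex {E : Set Plane} (hE : Convex ℝ E) (hEB : E ⊆ P.boundary ℝ)
    {x y z : Plane} (hy : y ∈ contacts P x) (hz : z ∈ contacts P x) (hyE : y ∈ E) (hzE : z ∈ E) :
    y = z :=
  eq_of_dist_eq_of_forall_dist_le hE (fun _ hw => rho_le_dist (hEB hw)) hyE hzE hy.2 hz.2

lemma contact_inner_nonpos {c a y : Plane} {E : Set Plane} (hE : Convex ℝ E)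
    (hEB : E ⊆ P.boundary ℝ) (ha : a ∈ contacts P c) (haE : a ∈ E) (hy : y ∈ E) :
    inner ℝ (c - a) (y - a) ≤ 0 :=
  inner_sub_nonpos_of_forall_dist_le hE haE (fun z hz => by
    rw [dist_comm, ha.2, dist_comm]; exact rho_le_dist (hEB hz)) hy

/-- Along the segment the inner product is affine and vanishes at `a`, so it is identically zero or
falls off with a fixed slope. -/
lemma exists_pos_forall_inner_le {c a p q : Plane} (ha : a ∈ segment ℝ p q)
    (h : ∀ y ∈ segment ℝ p q, inner ℝ (c - a) (y - a) ≤ 0) :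
    ∃ δ > 0, ∀ y ∈ segment ℝ p q,
      inner ℝ (c - a) (y - a) = 0 ∨ inner ℝ (c - a) (y - a) ≤ -δ * ‖y - a‖ := by
  rw [segment_eq_image'] at ha h ⊢
  obtain ⟨t₀, ht₀, rfl⟩ := ha
  set a := p + t₀ • (q - p)
  have e : ∀ t : ℝ, p + t • (q - p) - a = (t - t₀) • (q - p) := fun t => by
    simp only [a]; module
  set k := inner ℝ (c - a) (q - p) with hk
  by_cases hk0 : k = 0
  · refine ⟨1, one_pos, ?_⟩
    rintro _ ⟨t, -, rfl⟩
    left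
    rw [e, inner_smul_right, ← hk, hk0, mul_zero]
  have hqp : 0 < ‖q - p‖ := by
    rw [norm_pos_iff]
    intro h0
    rw [h0, inner_zero_right] at hk
    exact hk0 hk
  refine ⟨|k| / ‖q - p‖, div_pos (abs_pos.2 hk0) hqp, ?_⟩
  rintro _ ⟨t, ht, rfl⟩
  right
  have h1 := h _ ⟨t, ht, rfl⟩
  simp only at h1 ⊢
  rw [e, inner_smul_right, ← hk] at h1
  rw [e, inner_smul_right, ← hk, norm_smul, Real.norm_eq_abs]
  have : -(|k| / ‖q - p‖) * (|t - t₀| * ‖q - p‖) = -|(t - t₀) * k| := by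
    rw [abs_mul]; field_simp
  rw [this, abs_of_nonpos h1, neg_neg]

lemma smul_mem_segment_of_le {a u : Plane} {s t : ℝ} (h : 0 ≤ s * t) (hst : |s| ≤ |t|) :
    a + s • u ∈ segment ℝ a (a + t • u) := by
  rw [segment_eq_image']
  rcases eq_or_ne t 0 with rfl | ht
  · have : s = 0 := by simpa using hst
    exact ⟨0, by simp, by simp [this]⟩
  refine ⟨s / t, ⟨?_, ?_⟩, ?_⟩
  · rw [← mul_div_mul_right s t ht]
    exact div_nonneg h (mul_self_nonneg t)
  · refine (le_abs_self _).trans ?_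
    rw [abs_div]
    exact div_le_one_of_le₀ hst (abs_nonneg t)
  · simp only [add_sub_cancel_left, smul_smul]
    rw [div_mul_cancel₀ s ht]

/-- A contact `w ≠ a` of `x` makes an acute angle with `x - a`. For `x` near `c` this excludes
directions making a definitely obtuse angle with `c - a`, so `y` and `z` both lie on the tangent at
`a`, on the same side of `a`. The nearer of them then lies on the edge of the other, and a convex
part of the boundary carries at most one contact. -/
lemma eventually_contacts_eq_of_edges {c a : Plane} (hca : c ≠ a) (ha : a ∈ contacts P c)
    {i j : Fin n} (hi : a ∈ P.edgeSet ℝ i) (hj : a ∈ P.edgeSet ℝ j) :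
    ∀ᶠ x in 𝓝 c, ∀ y ∈ contacts P x, ∀ z ∈ contacts P x, y ∈ P.edgeSet ℝ i → z ∈ P.edgeSet ℝ j →
      y = z := by
  have key : ∀ k, a ∈ P.edgeSet ℝ k → ∃ δ > 0, ∀ y ∈ P.edgeSet ℝ k,
      inner ℝ (c - a) (y - a) = 0 ∨ inner ℝ (c - a) (y - a) ≤ -δ * ‖y - a‖ := by
    intro k hk
    have h1 : ∀ y ∈ P.edgeSet ℝ k, inner ℝ (c - a) (y - a) ≤ 0 := fun y hy =>
      contact_inner_nonpos (convex_edgeSet P k) (edgeSet_subset_boundary P k) ha hk hy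
    rw [edgeSet_eq_segment] at hk h1 ⊢
    exact exists_pos_forall_inner_le hk h1
  obtain ⟨δ, hδ, hiδ⟩ := key i hi
  obtain ⟨η, hη, hjη⟩ := key j hj
  filter_upwards [ball_mem_nhds c hδ, ball_mem_nhds c hη] with x hxδ hxη y hy z hz hyi hzj
  have ci := convex_edgeSet P i
  have cj := convex_edgeSet P j
  have bi := edgeSet_subset_boundary P i
  have bj := edgeSet_subset_boundary P j
  rcases eq_or_ne y a with rfl | hya
  · exact contact_unique_of_convex cj bj hy hz hj hzj
  rcases eq_or_ne z a with rfl | hza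
  · exact contact_unique_of_convex ci bi hy hz hyi hi
  have pos : ∀ w ∈ contacts P x, w ≠ a → 0 < inner ℝ (x - a) (w - a) := fun w hw hwa =>
    inner_sub_pos_of_dist_le (by
      rw [dist_comm x w, hw.2, dist_comm x a]; exact rho_le_dist ha.1) hwa
  have perp : ∀ w ∈ contacts P x, w ≠ a → ∀ ε, dist x c < ε →
      (inner ℝ (c - a) (w - a) = 0 ∨ inner ℝ (c - a) (w - a) ≤ -ε * ‖w - a‖) →
      inner ℝ (c - a) (w - a) = 0 := by
    intro w hw hwa ε hε h
    refine h.resolve_right fun h => ?_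
    have h1 := pos w hw hwa
    have h2 : inner ℝ (x - a) (w - a) = inner ℝ (x - c) (w - a) + inner ℝ (c - a) (w - a) := by
      rw [← inner_add_left]; congr 1; abel
    have h3 := real_inner_le_norm (x - c) (w - a)
    rw [dist_eq_norm] at hε
    have h4 : ‖x - c‖ * ‖w - a‖ ≤ ε * ‖w - a‖ := by gcongr
    linarith
  have py := perp y hy hya δ hxδ (hiδ y hyi)
  have pz := perp z hz hza η hxη (hjη z hzj)
  set m := ‖c - a‖⁻¹ • (c - a) with hm
  have hm1 : ‖m‖ = 1 := by
    rw [hm, norm_smul, norm_inv, norm_norm, inv_mul_cancel₀ (norm_ne_zero_iff.2 (sub_ne_zero.2 hca))]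
  have dir : ∀ w, inner ℝ (c - a) (w - a) = 0 → w = a + inner ℝ (w - a) (rot m) • rot m := by
    intro w hw
    have h1 := eq_inner_smul_add hm1 (w - a)
    have h2 : inner ℝ (w - a) m = 0 := by
      rw [hm, inner_smul_right, real_inner_comm, hw, mul_zero]
    rw [h2, zero_smul, zero_add] at h1
    rw [← h1]; abel
  have ey := dir y py
  have ez := dir z pz
  set s := inner ℝ (y - a) (rot m)
  set t := inner ℝ (z - a) (rot m)
  have qy := pos y hy hya
  have qz := pos z hz hza
  rw [ey, add_sub_cancel_left, inner_smul_right] at qy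
  rw [ez, add_sub_cancel_left, inner_smul_right] at qz
  have hst : 0 ≤ s * t := by
    have h1 := mul_pos qy qz
    have h2 : 0 ≤ inner ℝ (x - a) (rot m) ^ 2 := sq_nonneg _
    by_contra hneg
    push Not at hneg
    nlinarith
  rcases le_total |s| |t| with hle | hle
  · refine contact_unique_of_convex cj bj hy hz (cj.segment_subset hj hzj ?_) hzj
    have := smul_mem_segment_of_le (a := a) (u := rot m) hst hle
    rwa [← ey, ← ez] at this
  · refine contact_unique_of_convex ci bi hy hz hyi (ci.segment_subset hi hyi ?_)
    have := smul_mem_segment_of_le (a := a) (u := rot m) (mul_comm s t ▸ hst) hle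
    rwa [← ey, ← ez] at this

lemma eventually_contacts_unique_near {c a : Plane} (hca : c ≠ a) (ha : a ∈ contacts P c) :
    ∀ᶠ x in 𝓝 c, ∀ y ∈ contacts P x, ∀ z ∈ contacts P x,
      (∀ i, y ∈ P.edgeSet ℝ i → a ∈ P.edgeSet ℝ i) →
      (∀ i, z ∈ P.edgeSet ℝ i → a ∈ P.edgeSet ℝ i) → y = z := by
  have h : ∀ᶠ x in 𝓝 c, ∀ i j : Fin n, a ∈ P.edgeSet ℝ i → a ∈ P.edgeSet ℝ j →
      ∀ y ∈ contacts P x, ∀ z ∈ contacts P x, y ∈ P.edgeSet ℝ i → z ∈ P.edgeSet ℝ j → y = z := by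
    rw [eventually_all]; intro i
    rw [eventually_all]; intro j
    by_cases hi : a ∈ P.edgeSet ℝ i
    · by_cases hj : a ∈ P.edgeSet ℝ j
      · filter_upwards [eventually_contacts_eq_of_edges hca ha hi hj] with x hx _ _
        exact hx
      · exact Eventually.of_forall fun x _ h => absurd h hj
    · exact Eventually.of_forall fun x h => absurd h hi
  filter_upwards [h] with x hx y hy z hz hya hza
  obtain ⟨i, hi⟩ := mem_iUnion.1 hy.1
  obtain ⟨j, hj⟩ := mem_iUnion.1 hz.1
  exact hx i j (hya i hi) (hza j hj) y hy z hz hi hj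

lemma two_le_encard_contacts {x : Plane} (h : 2 ≤ (contacts P x).encard) :
    ∃ y ∈ contacts P x, ∃ z ∈ contacts P x, y ≠ z := by
  have : 1 < (contacts P x).encard := lt_of_lt_of_le (by norm_num) h
  obtain ⟨y, z, hy, hz, hne⟩ := one_lt_encard_iff.1 this
  exact ⟨y, hy, z, hz, hne⟩

/-- The edge of `y` passes through `a`, so it lies beyond the tangent to the circle of `c` at `a`.
The left side is `rho P c` times the signed distance from `x` to that tangent. -/
lemma le_rho_mul_of_contact {c a x y : Plane} (ha : a ∈ contacts P c) (hy : y ∈ contacts P x)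
    (hya : ∀ i, y ∈ P.edgeSet ℝ i → a ∈ P.edgeSet ℝ i) :
    rho P c ^ 2 - inner ℝ (x - c) (a - c) ≤ rho P x * rho P c := by
  obtain ⟨i, hi⟩ := mem_iUnion.1 hy.1
  have h1 := contact_inner_nonpos (convex_edgeSet P i) (edgeSet_subset_boundary P i) ha
    (hya i hi) hi
  have h2 := real_inner_le_norm (y - x) (a - c)
  rw [← dist_eq_norm, ← dist_eq_norm, hy.2, ha.2] at h2
  have h3 : inner ℝ (y - x) (a - c) =
      -inner ℝ (c - a) (y - a) + ‖a - c‖ ^ 2 - inner ℝ (x - c) (a - c) := by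
    rw [← real_inner_self_eq_norm_sq, real_inner_comm (y - a) (c - a), ← neg_sub a c,
      inner_neg_right, neg_neg, ← inner_add_left, ← inner_sub_left]
    congr 1; abel
  rw [← dist_eq_norm, ha.2] at h3
  linarith

/-- Near a point with exactly two contacts, the circles with two contacts touch the boundary near
both of these. -/
theorem eventually_le_rho_mul {c a b : Plane} (hc : c ∉ P.boundary ℝ)
    (hab : contacts P c = {a, b}) :
    ∀ᶠ x in 𝓝 c, 2 ≤ (contacts P x).encard →
      rho P c ^ 2 - inner ℝ (x - c) (a - c) ≤ rho P x * rho P c ∧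
      rho P c ^ 2 - inner ℝ (x - c) (b - c) ≤ rho P x * rho P c := by
  have ha : a ∈ contacts P c := by rw [hab]; exact mem_insert a _
  have hb : b ∈ contacts P c := by rw [hab]; exact mem_insert_of_mem _ rfl
  have hca : c ≠ a := fun h => hc (h ▸ ha.1)
  have hcb : c ≠ b := fun h => hc (h ▸ hb.1)
  have hU := eventually_contacts_subset (P := P) (c := c)
    (U := {y | ∀ i, y ∈ P.edgeSet ℝ i → a ∈ P.edgeSet ℝ i} ∪
      {y | ∀ i, y ∈ P.edgeSet ℝ i → b ∈ P.edgeSet ℝ i}) (by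
    intro y hy
    rw [hab] at hy
    rcases hy with rfl | rfl
    · exact mem_of_superset (eventually_mem_edgeSet P _) subset_union_left
    · exact mem_of_superset (eventually_mem_edgeSet P _) subset_union_right)
  filter_upwards [hU, eventually_contacts_unique_near hca ha,
    eventually_contacts_unique_near hcb hb] with x hx hxa hxb h2
  obtain ⟨y, hy, z, hz, hne⟩ := two_le_encard_contacts h2
  rcases hx hy with hya | hyb <;> rcases hx hz with hza | hzb
  · exact absurd (hxa y hy z hz hya hza) hne
  · exact ⟨le_rho_mul_of_contact ha hy hya, le_rho_mul_of_contact hb hz hzb⟩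
  · exact ⟨le_rho_mul_of_contact ha hz hza, le_rho_mul_of_contact hb hy hyb⟩
  · exact absurd (hxb y hy z hz hyb hzb) hne

/-- The circle around `z` through `a` touches the larger circle around `c` from inside, at `a`
alone. -/
lemma not_two_le_contacts_of_mem_spoke {c a z : Plane} (ha : a ∈ contacts P c)
    (hz : z ∈ segment ℝ c a) (hzc : z ≠ c) : ¬ 2 ≤ (contacts P z).encard := by
  intro h2
  obtain ⟨y, hy, y', hy', hne⟩ := two_le_encard_contacts h2
  rw [segment_eq_image'] at hz
  obtain ⟨t, ⟨ht0, ht1⟩, rfl⟩ := hz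
  have ht : 0 < t := lt_of_le_of_ne ht0 fun h => hzc (by simp [← h])
  have key : ∀ w ∈ contacts P (c + t • (a - c)), w = a := by
    intro w hw
    have h1 : dist w (c + t • (a - c)) ≤ dist a (c + t • (a - c)) := by
      rw [hw.2]; exact rho_le_dist ha.1
    have h2 : dist a (c + t • (a - c)) = (1 - t) * rho P c := by
      rw [dist_eq_norm, show a - (c + t • (a - c)) = (1 - t) • (a - c) by module, norm_smul,
        Real.norm_of_nonneg (by linarith), ← dist_eq_norm, ha.2]
    have h3 : rho P c ≤ dist w c := rho_le_dist hw.1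
    have h4 : dist w (c + t • (a - c)) ^ 2 =
        ‖w - c‖ ^ 2 - 2 * (t * inner ℝ (w - c) (a - c)) + (t * rho P c) ^ 2 := by
      rw [dist_eq_norm, ← sub_sub, norm_sub_sq_real, inner_smul_right, norm_smul,
        Real.norm_of_nonneg ht0, ← dist_eq_norm a c, ha.2]
    have h5 : ‖w - a‖ ^ 2 = ‖w - c‖ ^ 2 - 2 * inner ℝ (w - c) (a - c) + rho P c ^ 2 := by
      rw [← ha.2, dist_eq_norm, ← norm_sub_sq_real, sub_sub_sub_cancel_right]
    rw [dist_eq_norm w c] at h3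
    have hr := rho_nonneg P c
    have h6 : dist w (c + t • (a - c)) ^ 2 ≤ ((1 - t) * rho P c) ^ 2 := by
      rw [← h2]; gcongr
    have h7 : rho P c ^ 2 ≤ ‖w - c‖ ^ 2 := by gcongr
    have h8 : t * ‖w - a‖ ^ 2 ≤ 0 := by
      have : (1 - t) * (rho P c ^ 2 - ‖w - c‖ ^ 2) ≤ 0 :=
        mul_nonpos_of_nonneg_of_nonpos (by linarith) (by linarith)
      nlinarith
    have h9 : ‖w - a‖ ^ 2 ≤ 0 := by
      by_contra hh
      push Not at hh
      have := mul_pos ht hh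
      linarith
    have h10 : ‖w - a‖ = 0 := by
      have := sq_nonneg ‖w - a‖
      exact pow_eq_zero_iff (two_ne_zero) |>.1 (le_antisymm h9 this)
    exact sub_eq_zero.1 (norm_eq_zero.1 h10)
  exact hne ((key y hy).trans (key y' hy').symm)

/-! ### Approach to a centre with two non-opposite contacts -/

lemma frame_of_coordinates {c a b m : Plane} {r p q : ℝ} (hm : ‖m‖ = 1) (hr : 0 < r) (hp : 0 < p)
    (hq : 0 < q) (hpq : p ^ 2 + q ^ 2 = r ^ 2) (ha : a - c = p • m + q • rot m)
    (hb : b - c = p • m - q • rot m) : Frame c a b m r (p / r) (q / r) where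
  r_pos := hr
  norm_m := hm
  C_pos := div_pos hp hr
  S_pos := div_pos hq hr
  sq_add := by field_simp; linarith
  a_eq := by
    rw [smul_add, smul_smul, smul_smul, mul_div_cancel₀ _ hr.ne', mul_div_cancel₀ _ hr.ne', ← ha]
    abel
  b_eq := by
    rw [smul_sub, smul_smul, smul_smul, mul_div_cancel₀ _ hr.ne', mul_div_cancel₀ _ hr.ne', ← hb]
    abel

/-- The direction `m` bisects the angle: it is the normalised sum of `a - c` and `b - c`. The
disjunction records which contact lies to the left of `m`. -/
lemma exists_frame {c a b : Plane} {r : ℝ} (hr : 0 < r) (ha : dist a c = r) (hb : dist b c = r)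
    (hab : a ≠ b) (hanti : a - c ≠ -(b - c)) :
    ∃ m C S, Frame c a b m r C S ∨ Frame c b a m r C S := by
  set u := (a - c) + (b - c) with hu
  have hu0 : u ≠ 0 := fun h => hanti (eq_neg_of_add_eq_zero_left h)
  have hun : 0 < ‖u‖ := norm_pos_iff.2 hu0
  rw [dist_eq_norm] at ha hb
  set m := ‖u‖⁻¹ • u with hm
  have hm1 : ‖m‖ = 1 := by rw [hm, norm_smul, norm_inv, norm_norm, inv_mul_cancel₀ hun.ne']
  have hum : u = ‖u‖ • m := by rw [hm, smul_smul, mul_inv_cancel₀ hun.ne', one_smul]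
  have huu : ‖u‖ ^ 2 = 2 * (r ^ 2 + inner ℝ (a - c) (b - c)) := by
    rw [hu, norm_add_sq_real, ha, hb]; ring
  have hau : inner ℝ (a - c) u = r ^ 2 + inner ℝ (a - c) (b - c) := by
    rw [hu, inner_add_right, real_inner_self_eq_norm_sq, ha]
  have hbu : inner ℝ (b - c) u = r ^ 2 + inner ℝ (a - c) (b - c) := by
    rw [hu, inner_add_right, real_inner_self_eq_norm_sq, hb, real_inner_comm]; ring
  have hp : inner ℝ (b - c) m = inner ℝ (a - c) m := by
    rw [hm, inner_smul_right, inner_smul_right, hau, hbu]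
  have hp0 : 0 < inner ℝ (a - c) m := by
    rw [hm, inner_smul_right, hau]
    have : 0 < ‖u‖ ^ 2 := by positivity
    exact mul_pos (inv_pos.2 hun) (by linarith)
  have hq : inner ℝ (b - c) (rot m) = -inner ℝ (a - c) (rot m) := by
    have h1 : inner ℝ u (rot m) = 0 := by rw [hum, inner_smul_left, inner_rot_self, mul_zero]
    rw [hu, inner_add_left] at h1
    linarith
  have ea := eq_inner_smul_add hm1 (a - c)
  have eb := eq_inner_smul_add hm1 (b - c)
  have hpq := norm_sq_eq_inner_sq hm1 (a - c)
  rw [hp, hq] at eb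
  rw [ha] at hpq
  set p := inner ℝ (a - c) m
  set q := inner ℝ (a - c) (rot m)
  rcases lt_trichotomy q 0 with h | h | h
  · refine ⟨m, p / r, -q / r, Or.inr (frame_of_coordinates hm1 hr hp0 (by linarith)
      (by rw [neg_sq]; exact hpq.symm) eb ?_)⟩
    rw [neg_smul, sub_neg_eq_add]; exact ea
  · rw [h] at ea eb
    rw [neg_zero] at eb
    exact absurd (sub_left_injective (ea.trans eb.symm)) hab
  · refine ⟨m, p / r, q / r, Or.inl (frame_of_coordinates hm1 hr hp0 h hpq.symm ea ?_)⟩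
    rw [eb, neg_smul, sub_eq_add_neg]

/-- The estimate behind the lemma that a path in the medial axis of radii at most `r` reaches the
centre of a frame through the near sector. -/
lemma lt_of_frame_estimates {r C S p q s : ℝ} (hC : 0 < C) (hS : 0 < S)
    (hCS : C ^ 2 + S ^ 2 = 1) (hq : 0 ≤ q) (hpq : p ≠ 0 ∨ q ≠ 0) (hp1 : p < r)
    (hp2 : p < 4 * r * S ^ 4) (hp3 : p < 2 * r * C * S ^ 2) (hs0 : 0 ≤ s) (hs : s ≤ r)
    (h1 : r - (p * C - q * S) ≤ s) (h2 : s ^ 2 ≤ r ^ 2 - 2 * r * (p * C + q * S) + p ^ 2 + q ^ 2) :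
    q * C < p * S ∧ s < r := by
  have hC1 : C ≤ 1 := by nlinarith
  have h3 : q * S ≤ p * C := by linarith
  have hqS : 0 ≤ q * S := by positivity
  have hp : 0 < p := by
    have h0 : 0 ≤ p := by
      by_contra hneg
      push Not at hneg
      nlinarith
    refine lt_of_le_of_ne h0 fun h => ?_
    rcases hpq with h' | h'
    · exact h' h.symm
    · have : 0 < q * S := by positivity
      rw [← h] at h3
      linarith
  have hr : 0 < r := hp.trans hp1
  have h4 : (p ^ 2 + q ^ 2) * S ^ 2 ≤ p ^ 2 := by
    have : (q * S) ^ 2 ≤ (p * C) ^ 2 := by gcongr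
    have e : (p ^ 2 + q ^ 2) * S ^ 2 = p ^ 2 * S ^ 2 + (q * S) ^ 2 := by ring
    have e' : p ^ 2 = p ^ 2 * S ^ 2 + (p * C) ^ 2 := by
      linear_combination (-p ^ 2) * hCS
    linarith
  -- Comparing the square of the tangent bound `h1` with `h2` cancels the terms in `p * C`. So `q`
  -- is of second order: centres approach `c` tangentially to `m`.
  have h5 : 4 * r * (q * S) ≤ p ^ 2 + q ^ 2 := by
    have h6 : 0 ≤ r - (p * C - q * S) := by nlinarith
    have h7 : (r - (p * C - q * S)) ^ 2 ≤ s ^ 2 := by gcongr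
    nlinarith [sq_nonneg (p * C - q * S)]
  constructor
  · have h6 : 4 * r * S ^ 3 * q < 4 * r * S ^ 3 * (p * S) := by
      have : 4 * r * (q * S) * S ^ 2 ≤ (p ^ 2 + q ^ 2) * S ^ 2 := by gcongr
      nlinarith [mul_lt_mul_of_pos_right hp2 hp]
    have h7 : q < p * S := lt_of_mul_lt_mul_left h6 (by positivity)
    nlinarith
  · have h6 : p ^ 2 + q ^ 2 < 2 * r * (p * C) := by
      have : (p ^ 2 + q ^ 2) * S ^ 2 < 2 * r * (p * C) * S ^ 2 := by
        nlinarith [mul_lt_mul_of_pos_right hp3 hp]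
      exact lt_of_mul_lt_mul_right this (by positivity)
    have h7 : s ^ 2 < r ^ 2 := by nlinarith
    exact lt_of_pow_lt_pow_left₀ 2 hr.le h7

namespace Frame

variable {c a b m : Plane} {r C S : ℝ}

lemma inner_a (h : Frame c a b m r C S) (x : Plane) :
    inner ℝ x (a - c) = r * (inner ℝ x m * C + inner ℝ x (rot m) * S) := by
  rw [h.a_eq, add_sub_cancel_left, inner_smul_right, inner_add_right, inner_smul_right,
    inner_smul_right]
  ring

lemma inner_b (h : Frame c a b m r C S) (x : Plane) :
    inner ℝ x (b - c) = r * (inner ℝ x m * C - inner ℝ x (rot m) * S) := by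
  rw [h.b_eq, add_sub_cancel_left, inner_smul_right, inner_sub_right, inner_smul_right,
    inner_smul_right]
  ring

/-- The radius at `x` is at least the distance to either tangent and at most the distance to either
contact. Here `lt_of_frame_estimates` is applied with the tangent at the contact across the axis and
the contact on the side of `x`. -/
theorem eventually_mem_nearSector (h : Frame c a b m (rho P c) C S) (hc : c ∉ P.boundary ℝ)
    (hab : contacts P c = {a, b}) :
    ∀ᶠ x in 𝓝 c, 2 ≤ (contacts P x).encard → x ≠ c → rho P x ≤ rho P c →
      x ∈ nearSector c m (rho P c) C S ∧ rho P x < rho P c := by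
  have ha : a ∈ contacts P c := by rw [hab]; exact mem_insert a _
  have hb : b ∈ contacts P c := by rw [hab]; exact mem_insert_of_mem _ rfl
  have hr := h.r_pos
  have hC := h.C_pos
  have hS := h.S_pos
  have ev : ∀ ε > 0, ∀ᶠ x in 𝓝 c, dist x c < ε := fun ε hε => ball_mem_nhds c hε
  filter_upwards [eventually_le_rho_mul hc hab, ev _ hr,
    ev (4 * rho P c * S ^ 4) (by positivity), ev (2 * rho P c * C * S ^ 2) (by positivity)]
    with x hx e1 e2 e3 hx2 hxc hxr
  obtain ⟨ga, gb⟩ := hx hx2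
  rw [h.inner_a] at ga
  rw [h.inner_b] at gb
  have da : rho P x ≤ ‖x - a‖ := by rw [← dist_eq_norm, dist_comm]; exact rho_le_dist ha.1
  have db : rho P x ≤ ‖x - b‖ := by rw [← dist_eq_norm, dist_comm]; exact rho_le_dist hb.1
  have na : ‖x - a‖ ^ 2 = ‖x - c‖ ^ 2 - 2 * inner ℝ (x - c) (a - c) + rho P c ^ 2 := by
    rw [← ha.2, dist_eq_norm, ← norm_sub_sq_real, sub_sub_sub_cancel_right]
  have nb : ‖x - b‖ ^ 2 = ‖x - c‖ ^ 2 - 2 * inner ℝ (x - c) (b - c) + rho P c ^ 2 := by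
    rw [← hb.2, dist_eq_norm, ← norm_sub_sq_real, sub_sub_sub_cancel_right]
  have hs0 := rho_nonneg P x
  have da' : rho P x ^ 2 ≤ ‖x - a‖ ^ 2 := by gcongr
  have db' : rho P x ^ 2 ≤ ‖x - b‖ ^ 2 := by gcongr
  have hn := norm_sq_eq_inner_sq h.norm_m (x - c)
  rw [na, h.inner_a] at da'
  rw [nb, h.inner_b] at db'
  have hpn : inner ℝ (x - c) m ≤ dist x c := by
    have := real_inner_le_norm (x - c) m
    rwa [h.norm_m, mul_one, ← dist_eq_norm] at this
  have hne : inner ℝ (x - c) m ≠ 0 ∨ |inner ℝ (x - c) (rot m)| ≠ 0 := by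
    by_contra hh
    push Not at hh
    rw [hh.1, abs_eq_zero.1 hh.2] at hn
    exact hxc (sub_eq_zero.1 (norm_eq_zero.1 (pow_eq_zero_iff two_ne_zero |>.1 (by linarith))))
  rw [hn] at da' db'
  set p := inner ℝ (x - c) m
  set q := inner ℝ (x - c) (rot m)
  have ga' : rho P c - (p * C + q * S) ≤ rho P x := by
    refine le_of_mul_le_mul_right ?_ hr
    linarith
  have gb' : rho P c - (p * C - q * S) ≤ rho P x := by
    refine le_of_mul_le_mul_right ?_ hr
    linarith
  have main := lt_of_frame_estimates (q := |q|) hC hS h.sq_add (abs_nonneg _) hne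
    (hpn.trans_lt e1) (hpn.trans_lt e2) (hpn.trans_lt e3) hs0 hxr
    (by rcases abs_cases q with ⟨hq, -⟩ | ⟨hq, -⟩ <;> rw [hq] <;> linarith)
    (by rcases abs_cases q with ⟨hq, -⟩ | ⟨hq, -⟩ <;> rw [hq] <;> nlinarith)
  exact ⟨⟨e1, main.1⟩, main.2⟩

end Frame

/-! ### The medial axis near a vertex -/

lemma exists_unit_segment {w p : Plane} (h : p ≠ w) :
    ∃ (e : Plane) (l : ℝ), ‖e‖ = 1 ∧ 0 < l ∧ p - w = l • e ∧
      ∀ y, y ∈ segment ℝ w p ↔ ∃ s, 0 ≤ s ∧ s ≤ l ∧ y = w + s • e := by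
  have hl : 0 < ‖p - w‖ := norm_pos_iff.2 (sub_ne_zero.2 h)
  refine ⟨‖p - w‖⁻¹ • (p - w), ‖p - w‖, ?_, hl, ?_, fun y => ?_⟩
  · rw [norm_smul, norm_inv, norm_norm, inv_mul_cancel₀ hl.ne']
  · rw [smul_smul, mul_inv_cancel₀ hl.ne', one_smul]
  · rw [segment_eq_image']
    constructor
    · rintro ⟨t, ⟨h0, h1⟩, rfl⟩
      refine ⟨t * ‖p - w‖, by positivity, by nlinarith, ?_⟩
      rw [smul_smul, mul_assoc, mul_inv_cancel₀ hl.ne', mul_one]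
    · rintro ⟨s, h0, h1, rfl⟩
      refine ⟨s / ‖p - w‖, ⟨by positivity, (div_le_one hl).2 h1⟩, ?_⟩
      simp only [smul_smul, div_eq_mul_inv]

/-- A contact in the relative interior of an edge is the foot of the perpendicular from `x`; the
second equation is Pythagoras. -/
lemma contact_foot {w e x : Plane} {l s : ℝ} (he : ‖e‖ = 1) {E : Set Plane} (hE : Convex ℝ E)
    (hEB : E ⊆ P.boundary ℝ) (hmem : ∀ t, 0 ≤ t → t ≤ l → w + t • e ∈ E) (hs : 0 < s) (hsl : s < l)
    (hy : w + s • e ∈ contacts P x) :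
    inner ℝ (x - w) e = s ∧ ‖x - w‖ ^ 2 = rho P x ^ 2 + s ^ 2 := by
  have h0 := contact_inner_nonpos hE hEB hy (hmem s hs.le hsl.le) (hmem 0 le_rfl (by linarith))
  have h1 := contact_inner_nonpos hE hEB hy (hmem s hs.le hsl.le) (hmem l (by linarith) le_rfl)
  rw [show w + (0 : ℝ) • e - (w + s • e) = (-s) • e by module, inner_smul_right] at h0
  rw [show w + l • e - (w + s • e) = (l - s) • e by module, inner_smul_right] at h1
  have h2 : inner ℝ (x - (w + s • e)) e = 0 := by
    apply le_antisymm
    · by_contra hh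
      push Not at hh
      nlinarith [mul_pos (sub_pos.2 hsl) hh]
    · by_contra hh
      push Not at hh
      nlinarith [mul_pos hs (neg_pos.2 hh)]
  have e1 : x - w = (x - (w + s • e)) + s • e := by abel
  have ee : inner ℝ e e = (1 : ℝ) := by rw [real_inner_self_eq_norm_sq, he]; norm_num
  constructor
  · rw [e1, inner_add_left, h2, inner_smul_left, ee]; simp
  · rw [e1, norm_add_sq_real, inner_smul_right, h2, norm_smul, he, Real.norm_eq_abs, mul_one,
      sq_abs, ← hy.2, dist_comm, dist_eq_norm]
    ring

/-- Near a vertex of a simple polygon, the centres of circles with two contacts lie on the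
bisector of the angle between the two edges. -/
theorem exists_vertex_bisector (hP : IsSimple P) {w : Plane} (hw : w ∈ range P.vertices) :
    ∃ (p : Plane) (T : Set Plane), segment ℝ w p ⊆ P.boundary ℝ ∧ Convex ℝ T ∧
      (∀ z ∈ T, 0 < inner ℝ (z - w) (p - w)) ∧ (∀ᶠ z in 𝓝 w, z ∈ T → z ∉ P.boundary ℝ) ∧
      ∀ᶠ x in 𝓝 w, 2 ≤ (contacts P x).encard → x ∈ T := by
  obtain ⟨hn, hinj, hsimple⟩ := hP
  obtain ⟨i, rfl⟩ := hw
  have rot_ne : ∀ k : Fin n, finRotate n k ≠ k := by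
    obtain ⟨N, rfl⟩ : ∃ N, n = N + 2 := ⟨n - 2, by omega⟩
    intro k hk
    rw [finRotate_apply] at hk
    simp at hk
  set j := (finRotate n).symm i with hj
  have hji : finRotate n j = i := (finRotate n).apply_symm_apply i
  have hij : i ≠ j := fun h => rot_ne j (by rw [hji]; exact h)
  set w := P.vertices i with hw
  set p := P (finRotate n i) with hp
  set p' := P j with hp'
  have hpw : p ≠ w := fun h => rot_ne i (hinj h)
  have hpw' : p' ≠ w := fun h => hij (hinj h).symm
  have Ei : P.edgeSet ℝ i = segment ℝ w p := edgeSet_eq_segment P i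
  have Ej : P.edgeSet ℝ j = segment ℝ w p' := by
    rw [edgeSet_eq_segment, hji, segment_symm]
  have only : ∀ k, w ∈ P.edgeSet ℝ k → k = i ∨ k = j := by
    intro k hk
    by_cases hki : k = i
    · exact Or.inl hki
    have := (hsimple k i hki ⟨hk, vertex_mem_edgeSet P i⟩).1
    rcases this with h | h
    · exact absurd (hinj h).symm hki
    · right
      rw [hj, hinj h, Equiv.symm_apply_apply]
  obtain ⟨e, l, he, hl, hpe, hEe⟩ := exists_unit_segment hpw
  obtain ⟨e', l', he', hl', hpe', hEe'⟩ := exists_unit_segment hpw'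
  -- With equal directions the two edges would share a point interior to both.
  have hee : e ≠ e' := by
    rintro rfl
    have hs : 0 < min l l' / 2 := by positivity
    have hs1 : min l l' / 2 < l := by
      have := min_le_left l l'; linarith
    have hs2 : min l l' / 2 < l' := by
      have := min_le_right l l'; linarith
    have h := (hsimple i j hij ⟨by rw [Ei, hEe]; exact ⟨_, hs.le, hs1.le, rfl⟩,
      by rw [Ej, hEe']; exact ⟨_, hs.le, hs2.le, rfl⟩⟩).1
    have he0 : e ≠ 0 := fun h => by simp [h] at he
    rcases h with h | h
    · have h1 : (min l l' / 2) • e = 0 := by simpa [hw] using h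
      rcases smul_eq_zero.1 h1 with h1 | h1
      exacts [hs.ne' h1, he0 h1]
    · have h1 : (min l l' / 2) • e = l • e := by
        rw [← hpe, hp, ← h]; abel
      exact hs1.ne (smul_left_injective ℝ he0 h1)
  have hie : inner ℝ e e' ≠ (1 : ℝ) := fun h =>
    hee ((inner_eq_one_iff_of_norm_eq_one he he').1 h)
  have ee : inner ℝ e e = (1 : ℝ) := by rw [real_inner_self_eq_norm_sq, he]; norm_num
  have ee' : inner ℝ e' e' = (1 : ℝ) := by rw [real_inner_self_eq_norm_sq, he']; norm_num
  refine ⟨p, {z | inner ℝ (z - w) (e - e') = 0 ∧ 0 < inner ℝ (z - w) e}, ?_, ?_, ?_, ?_, ?_⟩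
  · rw [← Ei]; exact edgeSet_subset_boundary P i
  · rintro x ⟨hx1, hx2⟩ y ⟨hy1, hy2⟩ s t hs ht hst
    have e1 : s • x + t • y - w = s • (x - w) + t • (y - w) := by
      have : w = (s + t) • w := by rw [hst, one_smul]
      nth_rewrite 1 [this]; module
    simp only [mem_ofPred_eq, e1, inner_add_left, inner_smul_left, conj_trivial, hx1, hy1]
    refine ⟨by simp, ?_⟩
    rcases hs.eq_or_lt with rfl | hs
    · have : t = 1 := by linarith
      subst this
      linarith
    · nlinarith [mul_pos hs hx2, mul_nonneg ht hy2.le]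
  · rintro z ⟨-, hz⟩
    rw [hpe, inner_smul_right]
    exact mul_pos hl hz
  · filter_upwards [eventually_mem_edgeSet P w] with z hz hzT hzB
    obtain ⟨h1, h2⟩ := hzT
    obtain ⟨k, hk⟩ := mem_iUnion.1 hzB
    rcases only k (hz k hk) with rfl | rfl
    · rw [Ei, hEe] at hk
      obtain ⟨s, -, -, rfl⟩ := hk
      rw [add_sub_cancel_left, inner_smul_left] at h1 h2
      rw [inner_sub_right, ee] at h1
      rw [ee] at h2
      simp only [conj_trivial] at h1 h2
      rcases mul_eq_zero.1 h1 with h | h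
      · rw [h] at h2; simp at h2
      · exact hie (by linarith)
    · rw [Ej, hEe'] at hk
      obtain ⟨s, -, -, rfl⟩ := hk
      rw [add_sub_cancel_left, inner_smul_left] at h1 h2
      rw [inner_sub_right, ee', real_inner_comm] at h1
      simp only [conj_trivial] at h1 h2
      rcases mul_eq_zero.1 h1 with h | h
      · rw [h] at h2; simp at h2
      · exact hie (by linarith)
  · have hwB : w ∈ P.boundary ℝ := vertex_mem_boundary P i
    -- Removing the far endpoints `p` and `p'` leaves only `w` to exclude before contacts are
    -- interior to their edges.
    have hU := eventually_contacts_subset (P := P) (c := w)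
      (U := {y | ∀ k, y ∈ P.edgeSet ℝ k → w ∈ P.edgeSet ℝ k} ∩ ({p}ᶜ ∩ {p'}ᶜ)) (by
      intro y hy
      have : y = w := by
        rw [← dist_eq_zero, hy.2]; exact rho_eq_zero_of_mem hwB
      rw [this]
      exact inter_mem (eventually_mem_edgeSet P w)
        (inter_mem (compl_singleton_mem_nhds hpw.symm) (compl_singleton_mem_nhds hpw'.symm)))
    filter_upwards [hU] with x hx h2
    obtain ⟨y, hy, z, hz, hne⟩ := two_le_encard_contacts h2
    have ci := convex_edgeSet P i
    have cj := convex_edgeSet P j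
    have bi := edgeSet_subset_boundary P i
    have bj := edgeSet_subset_boundary P j
    have onE : ∀ y ∈ contacts P x, y ∈ P.edgeSet ℝ i ∨ y ∈ P.edgeSet ℝ j := by
      intro y hy
      obtain ⟨k, hk⟩ := mem_iUnion.1 hy.1
      rcases only k ((hx hy).1 k hk) with rfl | rfl
      exacts [Or.inl hk, Or.inr hk]
    have main : ∀ y ∈ contacts P x, ∀ z ∈ contacts P x, y ≠ z → y ∈ P.edgeSet ℝ i →
        z ∈ P.edgeSet ℝ j → inner ℝ (x - w) (e - e') = 0 ∧ 0 < inner ℝ (x - w) e := by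
      intro y hy z hz hne hyi hzj
      have hyw : y ≠ w := by
        rintro rfl
        exact hne (contact_unique_of_convex cj bj hy hz
          (by rw [Ej]; exact left_mem_segment ℝ _ _) hzj)
      have hzw : z ≠ w := by
        rintro rfl
        exact hne (contact_unique_of_convex ci bi hy hz hyi
          (by rw [Ei]; exact left_mem_segment ℝ _ _))
      have hyp : y ≠ p := (hx hy).2.1
      have hzp : z ≠ p' := (hx hz).2.2
      have hwp : w + l • e = p := by rw [← hpe]; abel
      have hwp' : w + l' • e' = p' := by rw [← hpe']; abel
      obtain ⟨s, s0, s1, rfl⟩ := (hEe y).1 (Ei ▸ hyi)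
      obtain ⟨t, t0, t1, rfl⟩ := (hEe' z).1 (Ej ▸ hzj)
      have s0' : 0 < s := lt_of_le_of_ne s0 fun h => hyw (by rw [← h]; simp)
      have t0' : 0 < t := lt_of_le_of_ne t0 fun h => hzw (by rw [← h]; simp)
      have s1' : s < l := lt_of_le_of_ne s1 fun h => hyp (by rw [h, hwp])
      have t1' : t < l' := lt_of_le_of_ne t1 fun h => hzp (by rw [h, hwp'])
      obtain ⟨f1, f2⟩ := contact_foot he ci bi
        (fun t h0 h1 => by rw [Ei, hEe]; exact ⟨t, h0, h1, rfl⟩) s0' s1' hy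
      obtain ⟨g1, g2⟩ := contact_foot he' cj bj
        (fun t h0 h1 => by rw [Ej, hEe']; exact ⟨t, h0, h1, rfl⟩) t0' t1' hz
      -- Both are the length of a tangent from `w` to the circle around `x`.
      have hst : s = t := by
        have : s ^ 2 = t ^ 2 := by linarith
        exact (pow_left_inj₀ s0 t0 two_ne_zero).1 this
      rw [inner_sub_right, f1, g1, hst]
      exact ⟨sub_self t, t0'⟩
    rcases onE y hy with hyi | hyj <;> rcases onE z hz with hzi | hzj
    · exact absurd (contact_unique_of_convex ci bi hy hz hyi hzi) hne
    · exact main y hy z hz hne hyi hzj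
    · exact main z hz y hy hne.symm hzi hyj
    · exact absurd (contact_unique_of_convex cj bj hy hz hyj hzj) hne

/-! ### The side function along paths in the medial axis -/

lemma vertices_subset_boundary (P : Polygon Plane n) : range P.vertices ⊆ P.boundary ℝ := by
  rintro _ ⟨i, rfl⟩
  exact vertex_mem_boundary P i

lemma mem_multiContact_of_notMem_boundary {x : Plane} (hx : x ∈ medialAxis P)
    (hB : x ∉ P.boundary ℝ) : x ∈ multiContact P :=
  hx.resolve_right fun h => hB (vertices_subset_boundary P h.1)

lemma notMem_boundary_of_mem_multiContact {x : Plane} (hx : x ∈ multiContact P) :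
    x ∉ P.boundary ℝ := hx.1.1

lemma notMem_spoke_of_mem_multiContact {c a x : Plane} (ha : a ∈ contacts P c)
    (hx : x ∈ multiContact P) (hxc : x ≠ c) : x ∉ segment ℝ c a :=
  fun h => not_two_le_contacts_of_mem_spoke ha h hxc hx.2

/-- The open disk of `c` misses the boundary, so `w` can lie on the radius only as `w = a`. Then the
edge towards `p` makes no acute angle with the radius, while all of `T` lies on its acute side. -/
lemma eventually_notMem_spoke {c a w p : Plane} {T : Set Plane} (hc : c ∉ P.boundary ℝ)
    (ha : a ∈ contacts P c) (hw : w ∈ P.boundary ℝ) (hwp : segment ℝ w p ⊆ P.boundary ℝ)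
    (hT : ∀ z ∈ T, 0 < inner ℝ (z - w) (p - w)) :
    ∀ᶠ z in 𝓝 w, z ∈ T → z ∉ segment ℝ c a := by
  by_cases hwa : w ∈ segment ℝ c a
  · have hwa' : w = a := by
      by_contra hne
      rw [segment_eq_image'] at hwa
      obtain ⟨t, ⟨h0, h1⟩, rfl⟩ := hwa
      have h2 := rho_le_dist (P := P) (x := c) hw
      rw [dist_eq_norm, add_sub_cancel_left, norm_smul, Real.norm_of_nonneg h0, ← dist_eq_norm,
        ha.2] at h2
      have h3 : 0 < rho P c := rho_pos ⟨_, hw⟩ hc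
      have h4 : t = 1 := by nlinarith
      exact hne (by rw [h4]; simp)
    subst hwa'
    refine Eventually.of_forall fun z hz hzs => ?_
    have h1 := hT z hz
    have h2 := contact_inner_nonpos (convex_segment w p) hwp ha (left_mem_segment ℝ w p)
      (right_mem_segment ℝ w p)
    rw [segment_symm, segment_eq_image'] at hzs
    obtain ⟨t, ⟨h0, -⟩, rfl⟩ := hzs
    rw [add_sub_cancel_left, inner_smul_left] at h1
    simp only [conj_trivial] at h1
    have := mul_nonpos_of_nonneg_of_nonpos h0 h2
    linarith
  · filter_upwards [(isClosed_segment c a).isOpen_compl.mem_nhds hwa] with z hz _ using hz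

/-- A locally constant function off the boundary and off the two radii of a circle to its contact
points extends over the leaves of the medial axis. -/
theorem exists_extension_medialAxis (hP : IsSimple P) {c a b : Plane} (hc : c ∉ P.boundary ℝ)
    (ha : a ∈ contacts P c) (hb : b ∈ contacts P c) {W : Plane → ℤ}
    (hW : ContinuousOn W (P.boundary ℝ ∪ (segment ℝ c a ∪ segment ℝ c b))ᶜ) :
    ∃ W' : Plane → ℤ, ContinuousOn W' (medialAxis P \ {c}) ∧ ∀ x ∈ multiContact P, W' x = W x := by
  classical
  set X := (P.boundary ℝ ∪ (segment ℝ c a ∪ segment ℝ c b))ᶜ with hX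
  have hXo : IsOpen X := ((isClosed_boundary P).union
    ((isClosed_segment c a).union (isClosed_segment c b))).isOpen_compl
  -- Near `w` all points with two contacts lie in a convex piece of the bisector inside `X`, so `W`
  -- has a single value on them; the leaf receives this value.
  have leaf : ∀ w ∈ range P.vertices, ∃ k : ℤ, ∀ᶠ x in 𝓝 w, x ∈ multiContact P → W x = k := by
    intro w hw
    have hwB := vertices_subset_boundary P hw
    obtain ⟨p, T, hp, hT, hTp, hTB, hTx⟩ := exists_vertex_bisector hP hw
    have ev : ∀ᶠ z in 𝓝 w, (z ∈ T → z ∈ X) ∧ (2 ≤ (contacts P z).encard → z ∈ T) := by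
      filter_upwards [hTB, hTx, eventually_notMem_spoke hc ha hwB hp hTp,
        eventually_notMem_spoke hc hb hwB hp hTp] with z h1 h2 h3 h4
      refine ⟨fun hz h => ?_, h2⟩
      rcases h with h | h | h
      exacts [h1 hz h, h3 hz h, h4 hz h]
    obtain ⟨δ, hδ, hball⟩ := Metric.eventually_nhds_iff_ball.1 ev
    have hS : IsPreconnected (T ∩ ball w δ) := (hT.inter (convex_ball w δ)).isPreconnected
    have hWS : ContinuousOn W (T ∩ ball w δ) := hW.mono fun z hz => (hball z hz.2).1 hz.1
    rcases (T ∩ ball w δ).eq_empty_or_nonempty with h0 | ⟨z, hz⟩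
    · refine ⟨0, ?_⟩
      filter_upwards [ball_mem_nhds w hδ] with x hx hxm
      have : x ∈ T ∩ ball w δ := ⟨(hball x hx).2 hxm.2, hx⟩
      rw [h0] at this
      exact absurd this (notMem_empty x)
    · refine ⟨W z, ?_⟩
      filter_upwards [ball_mem_nhds w hδ] with x hx hxm
      exact hS.constant hWS ⟨(hball x hx).2 hxm.2, hx⟩ hz
  choose! k hk using leaf
  have hval : ∀ x ∈ multiContact P,
      (if x ∈ multiContact P then W x else k x) = W x := fun x hx => if_pos hx
  refine ⟨fun x => if x ∈ multiContact P then W x else k x, ?_, hval⟩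
  rintro x ⟨hx, hxc⟩
  have hxc : x ≠ c := hxc
  by_cases hxm : x ∈ multiContact P
  · have hxX : x ∈ X := by
      rintro (h | h | h)
      exacts [hxm.1.1 h, notMem_spoke_of_mem_multiContact ha hxm hxc h,
        notMem_spoke_of_mem_multiContact hb hxm hxc h]
    have hWx : ContinuousAt W x := hW.continuousAt (hXo.mem_nhds hxX)
    have h1 : ∀ᶠ y in 𝓝 x, W y = W x :=
      hWx.tendsto.eventually ((isOpen_discrete {W x}).mem_nhds rfl)
    refine tendsto_const_nhds.congr' ?_
    filter_upwards [self_mem_nhdsWithin, mem_nhdsWithin_of_mem_nhds h1,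
      mem_nhdsWithin_of_mem_nhds (hXo.mem_nhds hxX)] with y hy hyW hyX
    have hym := mem_multiContact_of_notMem_boundary hy.1 fun h => hyX (Or.inl h)
    rw [hval y hym, hval x hxm, hyW]
  · have hxv : x ∈ range P.vertices := (hx.resolve_left hxm).1
    have hfin : ∀ᶠ y in 𝓝 x, y ∈ range P.vertices → y = x := by
      have hcl : IsClosed (range P.vertices \ {x}) :=
        ((finite_range P.vertices).subset sdiff_subset).isClosed
      filter_upwards [hcl.isOpen_compl.mem_nhds fun h => h.2 rfl] with y hy hyv
      by_contra hne
      exact hy ⟨hyv, hne⟩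
    refine tendsto_const_nhds.congr' ?_
    filter_upwards [self_mem_nhdsWithin, mem_nhdsWithin_of_mem_nhds (hk x hxv),
      mem_nhdsWithin_of_mem_nhds hfin] with y hy hyk hyf
    rw [if_neg hxm]
    by_cases hym : y ∈ multiContact P
    · rw [if_pos hym, hyk hym]
    · rw [if_neg hym, hyf (hy.1.resolve_left hym).1]

lemma eventually_mem_multiContact {c : Plane} (hc : c ∉ P.boundary ℝ) :
    ∀ᶠ x in 𝓝 c, x ∈ medialAxis P → x ∈ multiContact P := by
  filter_upwards [(isClosed_boundary P).isOpen_compl.mem_nhds hc] with x hx hxM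
  exact mem_multiContact_of_notMem_boundary hxM hx

/-- A path in the medial axis that ends in a point with two contacts and along which the radii do
not exceed the final one starts on the near side of the final circle. -/
theorem Frame.eq_of_path (hP : IsSimple P) {c a b m : Plane} {C S : ℝ}
    (h : Frame c a b m (rho P c) C S) (hc : c ∉ P.boundary ℝ) (hab : contacts P c = {a, b})
    {W : Plane → ℤ} {k : ℤ}
    (hW : ContinuousOn W (P.boundary ℝ ∪ (segment ℝ c a ∪ segment ℝ c b))ᶜ)
    (hWk : ∀ x ∈ nearSector c m (rho P c) C S, W x = k) {y : Plane} (hy : y ∈ multiContact P)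
    (hyc : y ≠ c) (γ : Path y c) (hγ : ∀ t, γ t ∈ medialAxis P ∧ rho P (γ t) ≤ rho P c) :
    W y = k := by
  have ha : a ∈ contacts P c := by rw [hab]; exact mem_insert a _
  have hb : b ∈ contacts P c := by rw [hab]; exact mem_insert_of_mem _ rfl
  obtain ⟨W', hW', hWW⟩ := exists_extension_medialAxis hP hc ha hb hW
  set g : C(ℝ, Plane) := γ.extend with hg
  have gc : Continuous g := g.continuous
  have gM : ∀ t, g t ∈ medialAxis P ∧ rho P (g t) ≤ rho P c := fun t => hγ _
  have g0 : g 0 = y := γ.extend_zero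
  have g1 : g 1 = c := γ.extend_one
  -- The infimum of `K` is the first time at `c`. Before it the path stays in the medial axis
  -- without `c`, where `W'` is continuous.
  set K := Icc (0 : ℝ) 1 ∩ g ⁻¹' {c} with hK
  have hKc : IsCompact K := isCompact_Icc.inter_right (isClosed_singleton.preimage gc)
  have hKne : K.Nonempty := ⟨1, ⟨by norm_num, le_rfl⟩, g1⟩
  obtain ⟨⟨ht0, ht1⟩, hgt⟩ := hKc.sInf_mem hKne
  set τ := sInf K
  have hgt : g τ = c := hgt
  have hτ : 0 < τ := lt_of_le_of_ne ht0 fun h0 => hyc (by rw [← g0, h0, hgt])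
  have hlt : ∀ t ∈ Ico 0 τ, g t ≠ c := fun t ht hgc =>
    absurd (csInf_le hKc.bddBelow (⟨⟨ht.1, ht.2.le.trans ht1⟩, hgc⟩ : t ∈ K)) (not_le.2 ht.2)
  have hpre : IsPreconnected (g '' Ico 0 τ) := isPreconnected_Ico.image g gc.continuousOn
  have hsub : g '' Ico 0 τ ⊆ medialAxis P \ {c} := by
    rintro _ ⟨t, ht, rfl⟩
    exact ⟨(gM t).1, hlt t ht⟩
  have ev : ∀ᶠ t in 𝓝[<] τ, g t ∈ medialAxis P → g t ≠ c → rho P (g t) ≤ rho P c →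
      g t ∈ multiContact P ∧ g t ∈ nearSector c m (rho P c) C S := by
    have h1 : Tendsto g (𝓝[<] τ) (𝓝 c) := by
      rw [← hgt]; exact gc.continuousAt.tendsto.mono_left nhdsWithin_le_nhds
    filter_upwards [h1.eventually (h.eventually_mem_nearSector hc hab),
      h1.eventually (eventually_mem_multiContact hc)] with t h2 h3 h4 h5 h6
    exact ⟨h3 h4, (h2 (h3 h4).2 h5 h6).1⟩
  obtain ⟨t, ht, htI⟩ := (ev.and (Ioo_mem_nhdsLT hτ)).exists
  have htI' : t ∈ Ico 0 τ := ⟨htI.1.le, htI.2⟩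
  obtain ⟨hm, hn⟩ := ht (gM t).1 (hlt t htI') (gM t).2
  have := hpre.constant (hW'.mono hsub) ⟨0, ⟨le_rfl, hτ⟩, g0⟩ ⟨t, htI', rfl⟩
  rw [hWW y hy, hWW _ hm, hWk _ hn] at this
  exact this

/-! ### Opposite contacts force a plateau -/

/-- The two contacts of a point that is reached, from an internal node, by a path in the medial
axis of no larger radii are not opposite to each other. -/
theorem sub_ne_neg_sub_of_path (hplat : NoPlateauAtNode P) {v c a b : Plane}
    (hv : v ∈ internalNodes P) (hc : c ∈ multiContact P) (hci : c ∉ internalNodes P)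
    (hab : contacts P c = {a, b}) (γ : Path v c)
    (hγ : ∀ t, γ t ∈ medialAxis P ∧ rho P (γ t) ≤ rho P c) : a - c ≠ -(b - c) := by
  intro hanti
  have hcB := notMem_boundary_of_mem_multiContact hc
  have hac : a ∈ contacts P c := by rw [hab]; exact mem_insert a _
  have hr : 0 < rho P c := rho_pos ⟨a, hac.1⟩ hcB
  set g : C(ℝ, Plane) := γ.symm.extend with hg
  have gc : Continuous g := g.continuous
  have gM : ∀ t, g t ∈ medialAxis P ∧ rho P (g t) ≤ rho P c := fun t => hγ _
  have g0 : g 0 = c := γ.symm.extend_zero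
  have g1 : g 1 = v := γ.symm.extend_one
  -- The times up to which the reversed path has kept the radius of `c`. This set is closed and
  -- extends to the right of each of its points, so the plateau reaches `v`.
  set s := {t : ℝ | ∀ u ∈ Icc 0 t, rho P (g u) = rho P c} with hs
  have plateau : ∀ t, 0 ≤ t → t ∈ s → (g '' Icc 0 t ∩ internalNodes P).Nonempty → False := by
    intro t h0 ht hne
    have hss := hplat (g '' Icc 0 t) (by rintro _ ⟨u, -, rfl⟩; exact (gM u).1)
      (isPreconnected_Icc.image g gc.continuousOn) hne (by
        rintro _ ⟨u, hu, rfl⟩ _ ⟨u', hu', rfl⟩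
        exact (ht u hu).trans (ht u' hu').symm)
    obtain ⟨x, hx, hxi⟩ := hne
    have : x = c := hss hx ⟨0, ⟨le_rfl, h0⟩, g0⟩
    exact hci (this ▸ hxi)
  have hclosed : IsClosed (s ∩ Icc 0 1) := by
    have hF : IsClosed {t : ℝ | rho P (g t) = rho P c} :=
      isClosed_eq ((continuous_rho P).comp gc) continuous_const
    rw [← isSeqClosed_iff_isClosed]
    intro f t hf hft
    have htI : t ∈ Icc (0 : ℝ) 1 := isClosed_Icc.mem_of_tendsto hft (Eventually.of_forall
      fun k => (hf k).2)
    refine ⟨fun u hu => ?_, htI⟩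
    rcases hu.2.eq_or_lt with rfl | hlt
    · exact hF.mem_of_tendsto hft (Eventually.of_forall fun k =>
        (hf k).1 _ ⟨(hf k).2.1, le_rfl⟩)
    · obtain ⟨k, hk⟩ := (hft.eventually (lt_mem_nhds hlt)).exists
      exact (hf k).1 u ⟨hu.1, hk.le⟩
  have hall : Icc (0 : ℝ) 1 ⊆ s := by
    refine hclosed.Icc_subset_of_forall_mem_nhdsWithin ?_ ?_
    · intro u hu
      have : u = 0 := le_antisymm hu.2 hu.1
      rw [this, g0]
    rintro t ⟨hts, ht0, ht1⟩
    set x := g t with hx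
    have hxr : rho P x = rho P c := hts t ⟨ht0, le_rfl⟩
    have hxB : x ∉ P.boundary ℝ := fun h => by
      rw [rho_eq_zero_of_mem h] at hxr; linarith
    have hxm := mem_multiContact_of_notMem_boundary (gM t).1 hxB
    have hxi : x ∉ internalNodes P := fun h =>
      plateau t ht0 hts ⟨x, ⟨t, ⟨ht0, le_rfl⟩, rfl⟩, h⟩
    have hx2 : (contacts P x).encard = 2 := by
      refine le_antisymm ?_ hxm.2
      by_contra hlt
      push Not at hlt
      exact hxi ⟨hxm.1, Order.add_one_le_of_lt hlt⟩
    obtain ⟨a', b', hne, hab'⟩ := encard_eq_two.1 hx2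
    have ha' : a' ∈ contacts P x := by rw [hab']; exact mem_insert a' _
    have hb' : b' ∈ contacts P x := by rw [hab']; exact mem_insert_of_mem _ rfl
    have hxpos : 0 < rho P x := by rw [hxr]; exact hr
    -- Otherwise nearby radii not exceeding that of `x` would be strictly smaller, yet plateau
    -- points of equal radius accumulate at `x`.
    have hanti' : a' - x = -(b' - x) := by
      by_contra hna
      have hstrict : ∀ᶠ y in 𝓝 x, 2 ≤ (contacts P y).encard → y ≠ x → rho P y ≤ rho P x →
          rho P y < rho P x := by
        obtain ⟨m, C, S, h | h⟩ := exists_frame hxpos ha'.2 hb'.2 hne hna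
        · filter_upwards [h.eventually_mem_nearSector hxB hab'] with y hy h1 h2 h3
          exact (hy h1 h2 h3).2
        · filter_upwards [h.eventually_mem_nearSector hxB (by rw [hab', pair_comm])]
            with y hy h1 h2 h3
          exact (hy h1 h2 h3).2
      have hxc : x ≠ c := by
        intro h
        rw [h, hab] at hab'
        rw [h] at hna
        apply hna
        rcases Set.pair_eq_pair_iff.1 hab' with ⟨rfl, rfl⟩ | ⟨rfl, rfl⟩
        · exact hanti
        · rw [hanti, neg_neg]
      have hpre : IsPreconnected (g '' Icc 0 t) := isPreconnected_Icc.image g gc.continuousOn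
      have hxA : x ∈ g '' Icc 0 t := ⟨t, ⟨ht0, le_rfl⟩, rfl⟩
      have hcA : c ∈ g '' Icc 0 t := ⟨0, ⟨le_rfl, ht0⟩, g0⟩
      have hacc := hpre.preperfect_of_nontrivial ⟨x, hxA, c, hcA, hxc⟩ x hxA
      rw [accPt_iff_frequently] at hacc
      obtain ⟨y, ⟨hyx, u, hu, rfl⟩, hys, hym⟩ :=
        (hacc.and_eventually (hstrict.and (eventually_mem_multiContact hxB))).exists
      have hyr := hts u hu
      have := hys (hym (gM u).1).2 hyx (by rw [hyr, hxr])
      linarith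
    -- With opposite contacts the two tangent bounds have opposite linear terms; their sum leaves
    -- `rho P x ≤ rho P y`.
    have hmin : ∀ᶠ y in 𝓝 x, y ∈ medialAxis P → rho P x ≤ rho P y := by
      filter_upwards [eventually_le_rho_mul hxB hab', eventually_mem_multiContact hxB]
        with y hy hym hyM
      obtain ⟨h1, h2⟩ := hy (hym hyM).2
      rw [hanti', inner_neg_right] at h1
      refine le_of_mul_le_mul_right ?_ hxpos
      nlinarith
    have hgt : ∀ᶠ u in 𝓝 t, rho P (g u) = rho P c := by
      filter_upwards [gc.continuousAt.eventually hmin] with u hu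
      exact le_antisymm (gM u).2 (hxr ▸ hu (gM u).1)
    obtain ⟨δ, hδ, hball⟩ := Metric.eventually_nhds_iff_ball.1 hgt
    filter_upwards [Ioo_mem_nhdsGT (show t < t + δ by linarith)] with u hu w hw
    rcases le_or_gt w t with hwt | hwt
    · exact hts w ⟨hw.1, hwt⟩
    · refine hball w ?_
      rw [mem_ball, Real.dist_eq, abs_of_pos (sub_pos.2 hwt)]
      linarith [hw.2, hu.2]
  exact plateau 1 zero_le_one (hall ⟨zero_le_one, le_rfl⟩) ⟨v, ⟨1, ⟨zero_le_one, le_rfl⟩, g1⟩, hv⟩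

/-! ### Points of a far half are closest to their own centre -/

lemma eq_of_mem_segment_of_dist_le {c a x : Plane} (hx : x ∈ segment ℝ c a)
    (h : dist a c ≤ dist x c) (hac : a ≠ c) : x = a := by
  rw [segment_eq_image'] at hx
  obtain ⟨t, ⟨h0, h1⟩, rfl⟩ := hx
  have hpos : 0 < ‖a - c‖ := norm_pos_iff.2 (sub_ne_zero.2 hac)
  rw [dist_eq_norm, dist_eq_norm, add_sub_cancel_left, norm_smul, Real.norm_of_nonneg h0] at h
  have : t = 1 := by nlinarith
  rw [this]; simp

/-- The directions in which the circle of radius `r` around the origin runs inside the disk of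
radius `r` around `w`. -/
def overlapCone (w : Plane) (r : ℝ) : Set Plane := {u | ‖w‖ ^ 2 * ‖u‖ < 2 * r * inner ℝ u w}

/-- The norm is sublinear and the right side linear. Convexity gives connectedness, so the image of
the cone on the circle serves as the connecting arc. -/
lemma convex_overlapCone (w : Plane) (r : ℝ) : Convex ℝ (overlapCone w r) := by
  intro x hx y hy s t hs ht hst
  simp only [overlapCone, mem_ofPred_eq] at hx hy ⊢
  rw [inner_add_left, inner_smul_left, inner_smul_left]
  simp only [conj_trivial]
  have h1 : ‖s • x + t • y‖ ≤ s * ‖x‖ + t * ‖y‖ := by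
    refine (norm_add_le _ _).trans ?_
    rw [norm_smul, norm_smul, Real.norm_of_nonneg hs, Real.norm_of_nonneg ht]
  have h2 : ‖w‖ ^ 2 * ‖s • x + t • y‖ ≤ ‖w‖ ^ 2 * (s * ‖x‖ + t * ‖y‖) := by gcongr
  rcases hs.eq_or_lt with rfl | hs
  · have : t = 1 := by linarith
    subst this
    linarith
  · nlinarith [mul_lt_mul_of_pos_left hx hs, mul_le_mul_of_nonneg_left hy.le ht]

lemma ne_zero_of_mem_overlapCone {w u : Plane} {r : ℝ} (h : u ∈ overlapCone w r) : u ≠ 0 := by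
  rintro rfl
  simp [overlapCone] at h

lemma norm_smul_sub_lt {w u : Plane} {r : ℝ} (hr : 0 < r) (h : u ∈ overlapCone w r) :
    ‖(r / ‖u‖) • u - w‖ < r := by
  have hu : 0 < ‖u‖ := norm_pos_iff.2 (ne_zero_of_mem_overlapCone h)
  have h1 : ‖(r / ‖u‖) • u - w‖ ^ 2 = r ^ 2 - 2 * (r / ‖u‖ * inner ℝ u w) + ‖w‖ ^ 2 := by
    rw [norm_sub_sq_real, inner_smul_left, norm_smul, Real.norm_of_nonneg (by positivity),
      div_mul_cancel₀ _ hu.ne']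
    simp
  have h2 : ‖w‖ ^ 2 < 2 * (r / ‖u‖ * inner ℝ u w) := by
    have : 2 * (r / ‖u‖ * inner ℝ u w) = (2 * r * inner ℝ u w) / ‖u‖ := by ring
    rw [this, lt_div_iff₀ hu]
    exact h
  exact lt_of_pow_lt_pow_left₀ 2 hr.le (by linarith)

/-- The far half of the disk around `c` is disjoint from the part of the disk of the same radius
around `c'` that is closer to `c'` than to `c`. -/
theorem Frame.dist_lt_of_mem_farHalf (hP : IsSimple P) {c a b m : Plane} {C S : ℝ}
    (h : Frame c a b m (rho P c) C S) (hc : c ∉ P.boundary ℝ) (hab : contacts P c = {a, b})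
    {c' : Plane} (hc' : c' ∈ multiContact P) (hne : c' ≠ c) (hrr : rho P c' = rho P c)
    (γ : Path c' c) (hγ : ∀ t, γ t ∈ medialAxis P ∧ rho P (γ t) ≤ rho P c) {z : Plane}
    (hz : z ∈ farHalf c m (rho P c)) : dist z c < dist z c' := by
  by_contra hclose
  push Not at hclose
  have ha : a ∈ contacts P c := by rw [hab]; exact mem_insert a _
  have hb : b ∈ contacts P c := by rw [hab]; exact mem_insert_of_mem _ rfl
  set r := rho P c with hr_def
  have hr : 0 < r := h.r_pos
  have hac : a ≠ c := fun h => hc (h ▸ ha.1)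
  have hbc : b ≠ c := fun h => hc (h ▸ hb.1)
  have hdisk : ∀ x, dist x c < r → x ∉ P.boundary ℝ := fun x hx hxB =>
    absurd (rho_le_dist (P := P) (x := c) hxB) (not_le.2 hx)
  have hdisk' : ∀ x, dist x c' < r → x ∉ P.boundary ℝ := fun x hx hxB =>
    absurd (rho_le_dist (P := P) (x := c') hxB) (not_le.2 (hrr ▸ hx))
  obtain ⟨W, k, l, hW, hkl, hWk, hWl⟩ := h.exists_side hdisk (logRatio_boundary P ha.1 hb.1)
  have hWc' : W c' = k := h.eq_of_path hP hc hab hW hWk hc' hne γ hγ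
  set X := (P.boundary ℝ ∪ (segment ℝ c a ∪ segment ℝ c b))ᶜ with hX
  -- Outside the open disk the radii have only their endpoints `a` and `b`, which are boundary
  -- points.
  have memX : ∀ x, x ∉ P.boundary ℝ → r ≤ dist x c → x ∈ X := by
    rintro x hxB hx (h' | h' | h')
    · exact hxB h'
    · exact hxB (eq_of_mem_segment_of_dist_le h' (by rwa [ha.2]) hac ▸ ha.1)
    · exact hxB (eq_of_mem_segment_of_dist_le h' (by rwa [hb.2]) hbc ▸ hb.1)
  set w := c' - c with hw
  have hw0 : 0 < ‖w‖ := norm_pos_iff.2 (sub_ne_zero.2 hne)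
  set u := z - c with hu
  have hzr : ‖u‖ < r := by rw [hu, ← dist_eq_norm]; exact hz.1
  have hzc' : dist z c' < r := hclose.trans_lt hz.1
  have hcone : u ∈ overlapCone w r := by
    have h1 : ‖z - c'‖ ^ 2 = ‖u‖ ^ 2 - 2 * inner ℝ u w + ‖w‖ ^ 2 := by
      rw [← norm_sub_sq_real, hu, hw, sub_sub_sub_cancel_right]
    rw [dist_eq_norm, dist_eq_norm, ← hu] at hclose
    have h2 : ‖z - c'‖ ^ 2 ≤ ‖u‖ ^ 2 := by gcongr
    have h3 : ‖w‖ ^ 2 * ‖u‖ < ‖w‖ ^ 2 * r := by gcongr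
    change ‖w‖ ^ 2 * ‖u‖ < 2 * r * inner ℝ u w
    nlinarith
  have hwcone : w ∈ overlapCone w r := by
    have h1 : ‖w‖ < 2 * r := by
      have := dist_triangle_left c' c z
      rw [hw, ← dist_eq_norm]
      linarith [hz.1]
    change ‖w‖ ^ 2 * ‖w‖ < 2 * r * inner ℝ w w
    rw [real_inner_self_eq_norm_sq]
    have : 0 < ‖w‖ ^ 2 := by positivity
    nlinarith
  let F : Plane → Plane := fun u => c + (r / ‖u‖) • u
  have hFc : ∀ u ∈ overlapCone w r, dist (F u) c = r := by
    intro u hu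
    have : 0 < ‖u‖ := norm_pos_iff.2 (ne_zero_of_mem_overlapCone hu)
    rw [dist_eq_norm, add_sub_cancel_left, norm_smul, Real.norm_of_nonneg (by positivity),
      div_mul_cancel₀ _ this.ne']
  have hFc' : ∀ u ∈ overlapCone w r, dist (F u) c' < r := by
    intro u hu
    rw [dist_eq_norm, show F u - c' = (r / ‖u‖) • u - w by simp only [F, hw]; abel]
    exact norm_smul_sub_lt hr hu
  -- Along the circle of `c`, inside the open disk of `c'`.
  have e1 : W (F u) = W (F w) := by
    have hFcont : ContinuousOn F (overlapCone w r) := by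
      have hq : ContinuousOn (fun u : Plane => r / ‖u‖) (overlapCone w r) :=
        continuousOn_const.div continuous_norm.continuousOn fun u hu =>
          norm_ne_zero_iff.2 (ne_zero_of_mem_overlapCone hu)
      simp only [F]
      fun_prop
    have hpre : IsPreconnected (F '' overlapCone w r) :=
      (convex_overlapCone w r).isPreconnected.image F hFcont
    refine hpre.constant (hW.mono ?_) ⟨u, hcone, rfl⟩ ⟨w, hwcone, rfl⟩
    rintro _ ⟨u, hu, rfl⟩
    exact memX _ (hdisk' _ (hFc' u hu)) (hFc u hu).ge
  -- Radially outward from `z`: the half-plane opposite to `m` misses both radii, and the disk of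
  -- `c'` misses the boundary.
  have e2 : W z = W (F u) := by
    refine (convex_segment z (F u)).isPreconnected.constant (hW.mono ?_)
      (left_mem_segment ℝ _ _) (right_mem_segment ℝ _ _)
    intro y hy
    have hyB : y ∉ P.boundary ℝ :=
      hdisk' y ((convex_ball c' r).segment_subset hzc' (hFc' u hcone) hy)
    rw [segment_eq_image'] at hy
    obtain ⟨t, ⟨h0, h1⟩, rfl⟩ := hy
    have hu0 : 0 < ‖u‖ := norm_pos_iff.2 (ne_zero_of_mem_overlapCone hcone)
    have hin : inner ℝ (z + t • (F u - z) - c) m < 0 := by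
      have e : z + t • (F u - z) - c = ((1 - t) + t * (r / ‖u‖)) • u := by
        have : z = c + u := by rw [hu]; abel
        simp only [F]
        nth_rewrite 1 2 [this]
        module
      rw [e, inner_smul_left]
      refine mul_neg_of_pos_of_neg ?_ hz.2
      have : 1 < r / ‖u‖ := (one_lt_div hu0).2 hzr
      simp only [conj_trivial]
      nlinarith
    obtain ⟨n1, n2⟩ := h.not_mem_spokes_of_inner_neg hin
    rintro (h' | h' | h')
    exacts [hyB h', n1 h', n2 h']
  -- Along the ray from `c` through `c'`. Beyond `c'`, a point on a radius would put `c'` on it too;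
  -- short of `c'`, the points are at distance at least `r` from `c`.
  have e3 : W (F w) = W c' := by
    refine (convex_segment (F w) c').isPreconnected.constant (hW.mono ?_)
      (left_mem_segment ℝ _ _) (right_mem_segment ℝ _ _)
    intro y hy
    have hyB : y ∉ P.boundary ℝ :=
      hdisk' y ((convex_ball c' r).segment_subset (hFc' w hwcone) (mem_ball_self hr) hy)
    rw [segment_symm, segment_eq_image'] at hy
    obtain ⟨t, ⟨h0, h1⟩, rfl⟩ := hy
    set τ := (1 - t) + t * (r / ‖w‖) with hτ
    have hrw : 0 < r / ‖w‖ := div_pos hr hw0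
    have ey : c' + t • (F w - c') = c + τ • w := by
      have : c' = c + w := by rw [hw]; abel
      simp only [F, hτ]
      nth_rewrite 1 2 [this]
      module
    beta_reduce at hyB ⊢
    rw [ey] at hyB ⊢
    have hτ0 : 0 < τ := by
      rcases h0.eq_or_lt with rfl | ht
      · simp [hτ]
      · have := mul_pos ht hrw
        simp only [hτ]; linarith
    rcases le_or_gt 1 τ with hτ1 | hτ1
    · have hmem : c' ∈ segment ℝ c (c + τ • w) := by
        rw [segment_eq_image']
        refine ⟨τ⁻¹, ⟨by positivity, inv_le_one_of_one_le₀ hτ1⟩, ?_⟩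
        simp only [add_sub_cancel_left, smul_smul]
        rw [inv_mul_cancel₀ hτ0.ne', one_smul, hw]; abel
      rintro (h' | h' | h')
      · exact hyB h'
      · exact notMem_spoke_of_mem_multiContact ha hc' hne
          ((convex_segment c a).segment_subset (left_mem_segment ℝ c a) h' hmem)
      · exact notMem_spoke_of_mem_multiContact hb hc' hne
          ((convex_segment c b).segment_subset (left_mem_segment ℝ c b) h' hmem)
    · refine memX _ hyB ?_
      rw [dist_eq_norm, add_sub_cancel_left, norm_smul, Real.norm_of_nonneg hτ0.le,
        ← div_le_iff₀ hw0]
      have : r / ‖w‖ < 1 := by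
        by_contra hh
        push Not at hh
        simp only [hτ] at hτ1
        nlinarith
      simp only [hτ]
      nlinarith
  exact hkl (by rw [← hWc', ← e3, ← e1, ← e2, hWl z hz])

/-! ### Counting by area -/

lemma ball_subset_farHalf {c m : Plane} (hm : ‖m‖ = 1) {r : ℝ} (hr : 0 < r) :
    ball (c - (r / 2) • m) (r / 2) ⊆ farHalf c m r := by
  intro z hz
  rw [mem_ball, dist_eq_norm] at hz
  set y := z - (c - (r / 2) • m) with hy
  have e : z - c = y - (r / 2) • m := by rw [hy]; abel
  refine ⟨?_, ?_⟩
  · rw [dist_eq_norm, e]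
    refine (norm_sub_le _ _).trans_lt ?_
    rw [norm_smul, hm, Real.norm_of_nonneg (by positivity)]
    linarith
  · rw [e, inner_sub_left, inner_smul_left, real_inner_self_eq_norm_sq, hm]
    have := real_inner_le_norm y m
    rw [hm] at this
    simp only [conj_trivial]
    linarith

lemma card_mul_sq_le_of_pairwise_disjoint_ball (s : Finset Plane) (g : Plane → Plane) {v : Plane}
    {ρ R : ℝ} (hρ : 0 ≤ ρ) (hR : 0 ≤ R)
    (hdisj : (s : Set Plane).PairwiseDisjoint fun c => ball (g c) ρ)
    (hsub : ∀ c ∈ s, ball (g c) ρ ⊆ ball v R) : s.card * ρ ^ 2 ≤ R ^ 2 := by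
  open MeasureTheory in
  have h1 : volume (⋃ c ∈ s, ball (g c) ρ) ≤ volume (ball v R) :=
    measure_mono (iUnion₂_subset hsub)
  rw [MeasureTheory.measure_biUnion_finset hdisj fun _ _ => measurableSet_ball] at h1
  simp only [MeasureTheory.Measure.addHaar_ball _ _ hρ,
    MeasureTheory.Measure.addHaar_ball _ _ hR, finrank_euclideanSpace, Fintype.card_fin,
    Finset.sum_const, nsmul_eq_mul] at h1
  have hV0 := (measure_ball_pos MeasureTheory.volume (0 : Plane) one_pos).ne'
  have hV1 := (measure_ball_lt_top (μ := MeasureTheory.volume) (x := (0 : Plane)) (r := 1)).ne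
  rw [← mul_assoc, ENNReal.mul_le_mul_iff_left hV0 hV1, ← ENNReal.ofReal_natCast,
    ← ENNReal.ofReal_mul (Nat.cast_nonneg _), ENNReal.ofReal_le_ofReal_iff (by positivity)] at h1
  exact h1

/-- The centres of the guiding circles of `v` of radius `r`. -/
def guidingCenters (P : Polygon Plane n) (v : Plane) (r : ℝ) : Set Plane :=
  {c | c ∈ medialAxis P ∧ rho P c = r ∧
    (∃ γ : Path v c, ∀ t, γ t ∈ medialAxis P ∧ rho P (γ t) ≤ r) ∧ Overlap (mec P c) (mec P v)}

lemma guidingCirclesOfRadius_subset (P : Polygon Plane n) (v : Plane) (r : ℝ) :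
    guidingCirclesOfRadius P v r ⊆ mec P '' guidingCenters P v r := by
  rintro C ⟨⟨c, hc, rfl, -, ⟨γ, hγ⟩, ho⟩, hr⟩
  have hr : rho P c = r := hr
  exact ⟨c, ⟨hc, hr, ⟨γ, fun t => ⟨(hγ t).1, hr ▸ (hγ t).2⟩⟩, ho⟩, rfl⟩

lemma pos_of_overlap {c v : Plane} (h : Overlap (mec P c) (mec P v)) :
    0 < rho P c ∧ 0 < rho P v ∧ dist c v < rho P c + rho P v := by
  obtain ⟨x, h1, h2⟩ := h
  have h1 : dist x c < rho P c := h1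
  have h2 : dist x v < rho P v := h2
  refine ⟨dist_nonneg.trans_lt h1, dist_nonneg.trans_lt h2, ?_⟩
  have := dist_triangle_left c v x
  linarith

lemma notMem_boundary_of_rho_pos {x : Plane} (h : 0 < rho P x) : x ∉ P.boundary ℝ :=
  fun hx => by rw [rho_eq_zero_of_mem hx] at h; exact lt_irrefl _ h

lemma exists_frame_of_mem_guidingCenters (hplat : NoPlateauAtNode P) {v : Plane}
    (hv : v ∈ internalNodes P) {r : ℝ} {c : Plane} (hc : c ∈ guidingCenters P v r)
    (hci : c ∉ internalNodes P) :
    ∃ m a b C S, contacts P c = {a, b} ∧ Frame c a b m (rho P c) C S := by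
  obtain ⟨hcM, hcr, ⟨γ, hγ⟩, ho⟩ := hc
  have hpos := (pos_of_overlap ho).1
  have hcm := mem_multiContact_of_notMem_boundary hcM (notMem_boundary_of_rho_pos hpos)
  have hc2 : (contacts P c).encard = 2 := by
    refine le_antisymm ?_ hcm.2
    by_contra hlt
    push Not at hlt
    exact hci ⟨hcm.1, Order.add_one_le_of_lt hlt⟩
  obtain ⟨a, b, hne, hab⟩ := encard_eq_two.1 hc2
  have ha : a ∈ contacts P c := by rw [hab]; exact mem_insert a _
  have hb : b ∈ contacts P c := by rw [hab]; exact mem_insert_of_mem _ rfl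
  have hna := sub_ne_neg_sub_of_path hplat hv hcm hci hab γ (hcr ▸ hγ)
  obtain ⟨m, C, S, h | h⟩ := exists_frame hpos ha.2 hb.2 hne hna
  · exact ⟨m, a, b, C, S, hab, h⟩
  · exact ⟨m, b, a, C, S, by rw [hab, pair_comm], h⟩

/-- With 36 centres the disjoint disks of radius `r / 2` would have the total area of a disk of
radius `3 * r`, but they fit into a strictly smaller one. -/
theorem encard_guidingCenters_sdiff_le (hP : IsSimple P) (hplat : NoPlateauAtNode P) {v : Plane}
    (hv : v ∈ internalNodes P) (r : ℝ) :
    (guidingCenters P v r \ internalNodes P).encard ≤ 35 := by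
  by_contra hlt
  push Not at hlt
  have h36 : (36 : ℕ∞) ≤ (guidingCenters P v r \ internalNodes P).encard :=
    Order.add_one_le_of_lt hlt
  obtain ⟨t, hts, htc⟩ := exists_subset_encard_eq h36
  have hfin : t.Finite := finite_of_encard_eq_coe (k := 36) htc
  obtain ⟨s, rfl⟩ := hfin.exists_finset_coe
  have hcard : s.card = 36 := by
    rw [encard_coe_eq_coe_finsetCard] at htc
    exact_mod_cast htc
  have hfr : ∀ c ∈ s, ∃ m a b C S, contacts P c = {a, b} ∧ Frame c a b m (rho P c) C S :=
    fun c hc => exists_frame_of_mem_guidingCenters hplat hv (hts hc).1 (hts hc).2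
  choose! m a b C S hab hF using hfr
  have hne : s.Nonempty := Finset.card_pos.1 (by omega)
  -- The farthest centre gives one radius `dist c₀ v + r` for all disks that is strictly below `3 *
  -- r`.
  obtain ⟨c₀, hc₀, hmax⟩ := s.exists_max_image (fun c => dist c v) hne
  have hrad : ∀ c ∈ s, rho P c = r := fun c hc => (hts hc).1.2.1
  have hr : 0 < r := hrad c₀ hc₀ ▸ (pos_of_overlap (hts hc₀).1.2.2.2).1
  have hlt2 : dist c₀ v < 2 * r := by
    obtain ⟨-, -, ⟨γ, hγ⟩, ho⟩ := (hts hc₀).1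
    have h1 := (pos_of_overlap ho).2.2
    -- The path starts at `v`, so `rho P v ≤ r`.
    have h2 := (hγ 0).2
    rw [γ.source] at h2
    rw [hrad c₀ hc₀] at h1
    linarith
  have hball : ∀ c ∈ s, ball (c - (r / 2) • m c) (r / 2) ⊆ farHalf c (m c) r := fun c hc =>
    ball_subset_farHalf (hF c hc).norm_m hr
  have hmulti : ∀ c ∈ s, c ∈ multiContact P := fun c hc =>
    mem_multiContact_of_notMem_boundary (hts hc).1.1
      (notMem_boundary_of_rho_pos (by rw [hrad c hc]; exact hr))
  have hlt : ∀ c ∈ s, ∀ c' ∈ s, c ≠ c' → ∀ z ∈ farHalf c (m c) r, dist z c < dist z c' := by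
    intro c hc c' hc' hcc z hz
    obtain ⟨-, -, ⟨γ, hγ⟩, -⟩ := (hts hc).1
    obtain ⟨-, -, ⟨γ', hγ'⟩, -⟩ := (hts hc').1
    have hz' : z ∈ farHalf c (m c) (rho P c) := by rw [hrad c hc]; exact hz
    -- The centres `c'` and `c` are joined through `v`; both halves of the path have radii at most
    -- `r`.
    refine (hF c hc).dist_lt_of_mem_farHalf hP (hmulti c hc).1.1 (hab c hc) (hmulti c' hc')
      hcc.symm (by rw [hrad c hc, hrad c' hc']) (γ'.symm.trans γ) ?_ hz'
    intro t
    rw [hrad c hc]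
    have ht : (γ'.symm.trans γ) t ∈ range (γ'.symm.trans γ) := mem_range_self t
    rw [Path.trans_range, Path.symm_range] at ht
    rcases ht with ⟨u, hu⟩ | ⟨u, hu⟩
    · rw [← hu]; exact hγ' u
    · rw [← hu]; exact hγ u
  have hvol := card_mul_sq_le_of_pairwise_disjoint_ball s (fun c => c - (r / 2) • m c) (v := v)
    (ρ := r / 2) (R := dist c₀ v + r) (by positivity) (by positivity) ?_ ?_
  · rw [hcard] at hvol
    have h0 : 0 ≤ dist c₀ v := dist_nonneg
    push_cast at hvol
    nlinarith
  · intro c hc c' hc' hcc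
    refine Set.disjoint_left.2 fun z hz hz' => ?_
    exact lt_asymm (hlt c hc c' hc' hcc z (hball c hc hz))
      (hlt c' hc' c hc hcc.symm z (hball c' hc' hz'))
  · intro c hc z hz
    have h1 := (hball c hc hz).1
    have h2 := hmax c hc
    have h3 := dist_triangle z c v
    rw [mem_ball]
    linarith

end QMEC

theorem mainTheorem8 {n : ℕ} (P : Polygon QMEC.Plane n) (hP : QMEC.IsSimple P)
    (hdist : QMEC.DistinctNodeRadii P) (hplat : QMEC.NoPlateauAtNode P)
    (v : QMEC.Plane) (hv : v ∈ QMEC.nodes P) (r : ℝ) (hr : r ∈ QMEC.radii P) :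
    (QMEC.guidingCirclesOfRadius P v r).encard ≤ 36 := by
  refine (encard_le_encard (QMEC.guidingCirclesOfRadius_subset P v r)).trans
    ((encard_image_le _ _).trans ?_)
  rcases hv with hv | hv
  · have h1 : (QMEC.guidingCenters P v r ∩ QMEC.internalNodes P).encard ≤ 1 := by
      rw [encard_le_one_iff]
      intro c c' hc hc'
      exact hdist c hc.2 c' hc'.2 (hc.1.2.1.trans hc'.1.2.1.symm)
    have h2 := QMEC.encard_guidingCenters_sdiff_le hP hplat hv r
    rw [← encard_sdiff_add_encard_inter _ (QMEC.internalNodes P)]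
    calc _ ≤ (35 : ℕ∞) + 1 := add_le_add h2 h1
      _ = 36 := by norm_num
  · have h0 : QMEC.guidingCenters P v r = ∅ := by
      refine eq_empty_of_forall_notMem fun c hc => ?_
      exact QMEC.notMem_boundary_of_rho_pos (QMEC.pos_of_overlap hc.2.2.2).2.1
        (QMEC.vertices_subset_boundary P hv.1)
    rw [h0, encard_empty]
    exact zero_le
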